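/- Let $N\ge 2$ be an integer, $I=[0,1]$, $x_i=i/N$ for $0\le i\le N$, and let $y_0,\dots,y_N\in\mathbb R$ with $y_0=y_N=0$. Let $L_i(x)=(x+i-1)/N$, which maps $I$ onto $I_i=[x_{i-1},x_i]$ ($1\le i\le N$), and let $h$ be the continuous function on $I$ that is linear on each $I_i$ and satisfies $h(x_i)=y_i$ for all $i$. Let $S:I\to\mathbb R$ satisfy $|S(x)|<1$ for all $x\in I$ and $|S(x')-S(x'')|\le\lambda_S|x'-x''|$ for all $x',x''\in I$, where $\lambda_S>0$ is a constant. Let $f:I\to\mathbb R$ be the corresponding generalized affine fractal interpolation function, i.e. the continuous function whose graph $\Gamma f=\{(x,f(x)):x\in I\}$ satisfies $\Gamma f=\bigcup_{i=1}^N W_i(\Gamma f)$, where $W_i(x,y)=\big(L_i(x),\,S(L_i(x))\,y+h(L_i(x))\big)$. For $k\ge1$, $1\le j\le N^k$ and $1\le i\le N$ put $I^k_j=\big[\tfrac{j-1}{N^k},\tfrac{j}{N^k}\big]$ and $I^k_{i,j}=L_i(I^k_j)$. Let $M_k$ be the $N^k\times N^k$ matrix whose entry in row $(i-1)N^{k-1}+\ell$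 (where $1\le i\le N$, $1\le\ell\le N^{k-1}$) and column $j$ is $\max_{I^k_{i,j}}|S|$ if $(\ell-1)N<j\le\ell N$, and $0$ otherwise; let $M'_k$ be the matrix defined in the same way with $\min_{I^k_{i,j}}|S|$ in place of the maximum. Write $\rho(\cdot)$ for the spectral radius. Put $\gamma(x)=\sum_{i=1}^N|S(L_i(x))|$, $\gamma_*=\min_{x\in I}\gamma(x)$, $M_f=\max_{x\in I}|f(x)|$, and $O_k(f,I)=\sum_{j=1}^{N^k}\sup_{x',x''\in I^k_j}|f(x')-f(x'')|$. Suppose that $S(x)>0$ for all $x\in I$, that $\gamma_*>1$, and that there is an integer $k_0\ge1$ with $$O_{k_0}(f,I)>\frac{\lambda_S M_f}{\gamma_*-1}.$$ Then the limits $\lim_{k\to\infty}\rho(M_k)$ and $\lim_{k\to\infty}\rho(M'_k)$ exist and are equal; their common value $\rho_S$ is positive, and the box dimension of $\Gamma f$ exists and equals $$\dim_B\Gamma f=1+\frac{\log\rho_S}{\log N}.$$ Here the upper and lower box dimensions of a bounded set $E\subset\mathbb R^2$ are the $\limsup$ and $\liminf$, as $\varepsilon\to0+$, of $\log\mathcal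 N_E(\varepsilon)/\log(1/\varepsilon)$, where $\mathcal N_E(\varepsilon)$ is the number of squares $[k_1\varepsilon,(k_1+1)\varepsilon]\times[k_2\varepsilon,(k_2+1)\varepsilon]$, $k_1,k_2\in\mathbb Z$, that meet $E$; the box dimension exists if the two agree, and is then their common value. -/

import Mathlib

open Set Filter Topology

noncomputable section

namespace GenAffineFIF

/-! ### Box dimension of planar sets -/

/-- The `ε`-coordinate square with index `k ∈ ℤ × ℤ`. -/
def coordSquare (ε : ℝ) (k : ℤ × ℤ) : Set (ℝ × ℝ) :=
  Icc (k.1 * ε) ((k.1 + 1) * ε) ×ˢ Icc (k.2 * ε) ((k.2 + 1) * ε)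

/-- The number of `ε`-coordinate squares that meet `E` (for bounded `E` and `ε > 0` it is finite). -/
def boxCount (E : Set (ℝ × ℝ)) (ε : ℝ) : ℕ :=
  {k : ℤ × ℤ | (coordSquare ε k ∩ E).Nonempty}.ncard

/-- Upper box dimension. -/
def upperBoxDim (E : Set (ℝ × ℝ)) : EReal :=
  limsup (fun ε : ℝ => ((Real.log (boxCount E ε) / Real.log (1 / ε) : ℝ) : EReal)) (𝓝[>] 0)

/-- Lower box dimension. -/
def lowerBoxDim (E : Set (ℝ × ℝ)) : EReal :=
  liminf (fun ε : ℝ => ((Real.log (boxCount E ε) / Real.log (1 / ε) : ℝ) : EReal)) (𝓝[>] 0)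

/-- The box dimension of `E` exists and equals `d`. -/
def HasBoxDim (E : Set (ℝ × ℝ)) (d : ℝ) : Prop :=
  upperBoxDim E = d ∧ lowerBoxDim E = d

/-! ### Generalized affine fractal interpolation functions -/

/-- The graph of `f` over `[a, b]`. -/
def graphOver (f : ℝ → ℝ) (a b : ℝ) : Set (ℝ × ℝ) :=
  (fun t => (t, f t)) '' Icc a b

/-- The linear function with value `u` at `a` and value `v` at `c` (where `a ≠ c`). -/
def chord (a c u v t : ℝ) : ℝ := u + (v - u) * ((t - a) / (c - a))

/-- The linear map `L_i : [x_0, x_N] → [x_{i-1}, x_i]`; here `i : Fin N` stands for `i + 1`, so that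
`i.castSucc` and `i.succ` are the indices of the left and the right end point. -/
def nodeMap {N : ℕ} (x : Fin (N + 1) → ℝ) (i : Fin N) : ℝ → ℝ :=
  chord (x 0) (x (Fin.last N)) (x i.castSucc) (x i.succ)

/-- The linear function `b` with `b(x_0) = y_0` and `b(x_N) = y_N`. -/
def baseLine {N : ℕ} (x y : Fin (N + 1) → ℝ) : ℝ → ℝ :=
  chord (x 0) (x (Fin.last N)) (y 0) (y (Fin.last N))

/-- The piecewise linear function `h` through the points `(x_i, y_i)`: the sum of `y_0` and of one
ramp for each `i`, which climbs linearly from `0` to `y_i - y_{i-1}` on `[x_{i-1}, x_i]` and is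
constant on either side. See `polyline_eq_chord`. -/
def polyline {N : ℕ} (x y : Fin (N + 1) → ℝ) (t : ℝ) : ℝ :=
  y 0 + ∑ i : Fin N, chord (x i.castSucc) (x i.succ) 0 (y i.succ - y i.castSucc)
    (max (x i.castSucc) (min (x i.succ) t))

/-- On `[x_{i-1}, x_i]` the function `h` is linear with end values `y_{i-1}` and `y_i`. -/
theorem polyline_eq_chord {N : ℕ} {x : Fin (N + 1) → ℝ} (hx : StrictMono x)
    (y : Fin (N + 1) → ℝ) (i : Fin N) {t : ℝ} (ht : t ∈ Icc (x i.castSucc) (x i.succ)) :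
    polyline x y t = chord (x i.castSucc) (x i.succ) (y i.castSucc) (y i.succ) t := by
  have hne : ∀ k : Fin N, x k.succ - x k.castSucc ≠ 0 := fun k =>
    (sub_pos.2 (hx Fin.castSucc_lt_succ)).ne'
  have key : ∀ k : Fin N, chord (x k.castSucc) (x k.succ) 0 (y k.succ - y k.castSucc)
      (max (x k.castSucc) (min (x k.succ) t)) =
      (if k < i then y k.succ - y k.castSucc else 0) +
        (if k = i then (y i.succ - y i.castSucc) *
          ((t - x i.castSucc) / (x i.succ - x i.castSucc)) else 0) := by
    intro k
    rcases lt_trichotomy k i with h | h | h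
    · have h1 : x k.succ ≤ x i.castSucc := hx.monotone (by
        simp only [Fin.le_def, Fin.val_succ, Fin.val_castSucc]; omega)
      have h2 : x k.castSucc ≤ x k.succ := (hx Fin.castSucc_lt_succ).le
      rw [min_eq_left (h1.trans ht.1), max_eq_right h2]
      simp [chord, h, h.ne, div_self (hne k)]
    · subst h
      rw [min_eq_right ht.2, max_eq_right ht.1]
      simp [chord]
    · have h1 : x i.succ ≤ x k.castSucc := hx.monotone (by
        simp only [Fin.le_def, Fin.val_succ, Fin.val_castSucc]; omega)
      rw [max_eq_left ((min_le_right _ _).trans (ht.2.trans h1))]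
      simp [chord, h.not_gt, h.ne']
  have tele : ∀ m : ℕ, ∀ hm : m < N + 1,
      ∑ k : Fin N, (if (k : ℕ) < m then y k.succ - y k.castSucc else 0) = y ⟨m, hm⟩ - y 0 := by
    intro m
    induction m with
    | zero => intro hm; simp
    | succ m ih =>
      intro hm
      have hs : ∀ k : Fin N, (if (k : ℕ) < m + 1 then y k.succ - y k.castSucc else 0) =
          (if (k : ℕ) < m then y k.succ - y k.castSucc else 0) +
          (if k = (⟨m, by omega⟩ : Fin N) then y k.succ - y k.castSucc else 0) := by
        intro k
        simp only [Fin.ext_iff]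
        split_ifs <;> first | omega | simp
      rw [Finset.sum_congr rfl fun k _ => hs k, Finset.sum_add_distrib, ih (by omega)]
      simp
  have ht' := tele i (by omega)
  simp only [← Fin.lt_def] at ht'
  rw [polyline, Finset.sum_congr rfl fun k _ => key k, Finset.sum_add_distrib, ht']
  simp only [Finset.sum_ite_eq', Finset.mem_univ, if_true, chord]
  have : (⟨(i : ℕ), by omega⟩ : Fin (N + 1)) = i.castSucc := rfl
  rw [this]; ring

/-- `F_i(t, v) = S(L_i(t)) (v - b(t)) + h(L_i(t))`. -/
def vertMap {N : ℕ} (x y : Fin (N + 1) → ℝ) (S : ℝ → ℝ) (i : Fin N) (t v : ℝ) : ℝ :=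
  S (nodeMap x i t) * (v - baseLine x y t) + polyline x y (nodeMap x i t)

/-- `W_i(t, v) = (L_i(t), F_i(t, v))`. -/
def ifsMap {N : ℕ} (x y : Fin (N + 1) → ℝ) (S : ℝ → ℝ) (i : Fin N) (p : ℝ × ℝ) : ℝ × ℝ :=
  (nodeMap x i p.1, vertMap x y S i p.1 p.2)

/-- `f` is the generalized affine fractal interpolation function of the data `(x_i, y_i)` with
vertical scaling function `S`: the continuous function on `[x_0, x_N]` whose graph is the invariant
set of the iterated function system `W_1, …, W_N`. -/
structure IsGenAffineFIF {N : ℕ} (x y : Fin (N + 1) → ℝ) (S f : ℝ → ℝ) : Prop where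
  continuousOn : ContinuousOn f (Icc (x 0) (x (Fin.last N)))
  invariant : graphOver f (x 0) (x (Fin.last N)) =
    ⋃ i : Fin N, ifsMap x y S i '' graphOver f (x 0) (x (Fin.last N))

/-- The uniformly spaced nodes `x_i = i / N` of `[0, 1]`. -/
def unifNodes (N : ℕ) (i : Fin (N + 1)) : ℝ := (i : ℕ) / (N : ℝ)

/-! ### Vertical scaling matrices
All indices below start at `0`. -/

/-- The `j`-th of the `N ^ k` subintervals of equal length of `[a, b]`, for `0 ≤ j < N ^ k`. -/
def subInterval (N : ℕ) (a b : ℝ) (k j : ℕ) : Set ℝ :=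
  Icc (a + j / (N : ℝ) ^ k * (b - a)) (a + (j + 1) / (N : ℝ) ^ k * (b - a))

/-- The `j`-th of the `N ^ k` subintervals of equal length of `[i / N, (i + 1) / N]`. -/
def cell (N k i j : ℕ) : Set ℝ := subInterval N (i / (N : ℝ)) ((i + 1) / (N : ℝ)) k j

/-- The maximum of `|S|` on a cell. -/
def upperScale (N : ℕ) (S : ℝ → ℝ) (k i j : ℕ) : ℝ := sSup ((fun x => |S x|) '' cell N k i j)

/-- The minimum of `|S|` on a cell. -/
def lowerScale (N : ℕ) (S : ℝ → ℝ) (k i j : ℕ) : ℝ := sInf ((fun x => |S x|) '' cell N k i j)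

/-- The `N ^ k × N ^ k` matrix (`k ≥ 1`) whose entry in row `i * N ^ (k - 1) + l`, where `i < N` and
`l < N ^ (k - 1)`, and column `j` is `s i j` if `l * N ≤ j < (l + 1) * N`, and `0` otherwise. -/
def scaleMatrix (N k : ℕ) (s : ℕ → ℕ → ℝ) : Matrix (Fin (N ^ k)) (Fin (N ^ k)) ℝ :=
  Matrix.of fun r j =>
    if ((r : ℕ) % N ^ (k - 1)) * N ≤ (j : ℕ) ∧ (j : ℕ) < ((r : ℕ) % N ^ (k - 1) + 1) * N then
      s ((r : ℕ) / N ^ (k - 1)) j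
    else 0

/-- The vertical scaling matrix `M_k`. -/
def upperMatrix (N : ℕ) (S : ℝ → ℝ) (k : ℕ) : Matrix (Fin (N ^ k)) (Fin (N ^ k)) ℝ :=
  scaleMatrix N k (upperScale N S k)

/-- The vertical scaling matrix `M'_k`. -/
def lowerMatrix (N : ℕ) (S : ℝ → ℝ) (k : ℕ) : Matrix (Fin (N ^ k)) (Fin (N ^ k)) ℝ :=
  scaleMatrix N k (lowerScale N S k)

/-- The spectral radius of a real square matrix: the largest modulus of a complex eigenvalue. -/
def specRadius {n : ℕ} (A : Matrix (Fin n) (Fin n) ℝ) : ℝ :=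
  (spectralRadius ℂ (A.map (fun a : ℝ => (a : ℂ)))).toReal

/-- `ρ` is the number `ρ_S`: the common limit of the spectral radii of `M_k` and of `M'_k`. -/
def IsRhoS (N : ℕ) (S : ℝ → ℝ) (ρ : ℝ) : Prop :=
  Tendsto (fun k => specRadius (upperMatrix N S k)) atTop (𝓝 ρ) ∧
    Tendsto (fun k => specRadius (lowerMatrix N S k)) atTop (𝓝 ρ)

/-! ### Sum function and oscillations -/

/-- The sum function `γ(x) = ∑ |S(L_i(x))|` for the uniform nodes of `[0, 1]`. -/
def sumFun (N : ℕ) (S : ℝ → ℝ) (t : ℝ) : ℝ := ∑ i : Fin N, |S (nodeMap (unifNodes N) i t)|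

/-- `γ_*`, the minimum of the sum function on `[0, 1]`. -/
def gammaMin (N : ℕ) (S : ℝ → ℝ) : ℝ := sInf (sumFun N S '' Icc 0 1)

/-- `M_f`, the maximum of `|f|` on `[0, 1]`. -/
def maxAbs (f : ℝ → ℝ) : ℝ := sSup ((fun t => |f t|) '' Icc 0 1)

/-- The oscillation of `g` on `U`. -/
def osc (g : ℝ → ℝ) (U : Set ℝ) : ℝ :=
  sSup {r : ℝ | ∃ s ∈ U, ∃ t ∈ U, r = |g s - g t|}

/-- `O_k(g, [a, b])`, the sum of the oscillations over the `N ^ k` equal subintervals. -/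
def oscSum (N : ℕ) (g : ℝ → ℝ) (a b : ℝ) (k : ℕ) : ℝ :=
  ∑ j ∈ Finset.range (N ^ k), osc g (subInterval N a b k j)

end GenAffineFIF

end

namespace GenAffineFIF

/-! Everything is governed by the transfer operator `L g (t) = ∑ S((t+i)/N) g((t+i)/N)`. Since `S`
is positive and Lipschitz on a compact interval, `log S` is `K`-Lipschitz for some `K`, and `L`
preserves the cone `LogLip K`. Hence each `L^n 1` is constant up to the factor `exp K`, Fekete's
lemma gives a growth rate `ρ`, and `ρ ≥ γ_* > 1`. No eigenfunction of `L` is needed: truncating the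
resolvent series of the function `1` gives, for every `r` in `(0, ρ)`, some `φ` in the cone with `L
φ ≥ r φ`, and for every `r > ρ` some `φ` with `L φ ≤ r φ` (`exists_growthRate`). These functions are
used twice.

Matrices. Sampled at the left end points of the cells, `φ` is a positive row vector, on which `M_k`
and `M'_k` act like `L` up to the factor `exp (2K / N^k)`. Collatz–Wielandt bounds then squeeze both
spectral radii to `ρ`, so `ρ_S = ρ`.

Oscillations. By the functional equation, a branch maps a cell of level `k` to a cell of level `k +
1` and multiplies the oscillation of `f` by a value of `S`, up to an error `O(N^{-k})`. There are
`N^k` cells, so the sums `W_k(φ)` of oscillations weighted by `φ` satisfy `W_{k+1}(φ) = W_k(L φ) +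
O(1)`. Sub- and super-eigenfunctions turn this into `W_{k+1} ≥ r W_k - C` and `W_{k+1} ≤ r W_k + C`.
The first forces growth like `r^k` only after some `W_m` exceeds `C / (r - 1)`, so `O_k → ∞` must be
known beforehand. That follows from the sharper inequality `O_{k+1} ≥ γ_* O_k - λ_S M_f`, in which
the linear parts cancel because `y_0 = y_N`, and whose threshold is the one assumed at `k_0`. Thus
`log O_k / k → log ρ`.

Finally, for `ε` comparable to `N^{-k}`, the number of squares meeting the graph is comparable to
`N^k O_k`, which gives the dimension. -/

/-! ### Log-Lipschitz functions and the transfer operator -/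

/-- `g` is positive on `[0, 1]` and `log g` is Lipschitz there with constant `K`. -/
def LogLip (K : ℝ) (g : ℝ → ℝ) : Prop :=
  ∀ s ∈ Icc (0 : ℝ) 1, 0 < g s ∧ ∀ t ∈ Icc (0 : ℝ) 1, g s ≤ Real.exp (K * |s - t|) * g t

/-- The transfer operator with weight `S` of the inverse branches `t ↦ (t + i) / N`. -/
noncomputable def transfer (N : ℕ) (S g : ℝ → ℝ) (t : ℝ) : ℝ :=
  ∑ i ∈ Finset.range N, S ((t + i) / N) * g ((t + i) / N)

theorem branch_mem {N i : ℕ} (hi : i < N) {t : ℝ} (ht : t ∈ Icc (0 : ℝ) 1) :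
    (t + i) / (N : ℝ) ∈ Icc (0 : ℝ) 1 := by
  have hN : (0 : ℝ) < N := by exact_mod_cast (by omega : 0 < N)
  have h : (i : ℝ) + 1 ≤ N := by exact_mod_cast hi
  have h0 : (0 : ℝ) ≤ i := i.cast_nonneg
  refine ⟨div_nonneg (by linarith [ht.1]) hN.le, (div_le_one hN).2 (by linarith [ht.2])⟩

theorem abs_branch_sub {N : ℕ} (i : ℕ) (s t : ℝ) :
    |(s + i) / (N : ℝ) - (t + i) / (N : ℝ)| = |s - t| / N := by
  rw [← sub_div, abs_div, Nat.abs_cast]; congr 2; ring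

/-- With `m > 0` the minimum of `S` on `[0, 1]`, `S s ≤ S t + lam |s - t| ≤ (1 + (lam / m) |s - t|)
S t`, and `1 + x ≤ exp x`. -/
theorem LogLip.of_lipschitz {S : ℝ → ℝ} {lam : ℝ} (hlam : 0 < lam)
    (hS : ∀ s ∈ Icc (0 : ℝ) 1, ∀ t ∈ Icc (0 : ℝ) 1, |S s - S t| ≤ lam * |s - t|)
    (hpos : ∀ t ∈ Icc (0 : ℝ) 1, 0 < S t) : ∃ K, 0 ≤ K ∧ LogLip K S := by
  have hcont : ContinuousOn S (Icc 0 1) := by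
    have : LipschitzOnWith (Real.toNNReal lam) S (Icc 0 1) := by
      refine LipschitzOnWith.of_dist_le_mul fun s hs t ht => ?_
      rw [Real.dist_eq, Real.dist_eq, Real.coe_toNNReal _ hlam.le]
      exact hS s hs t ht
    exact this.continuousOn
  obtain ⟨m, hm, hmin⟩ := isCompact_Icc.exists_isMinOn (nonempty_Icc.2 zero_le_one) hcont
  refine ⟨lam / S m, div_nonneg hlam.le (hpos m hm).le, fun s hs => ⟨hpos s hs, fun t ht => ?_⟩⟩
  have h1 : S s ≤ S t + lam * |s - t| := by linarith [le_abs_self (S s - S t), hS s hs t ht]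
  have h2 : lam * |s - t| ≤ (lam / S m * |s - t|) * S t := by
    have : lam * |s - t| = (lam / S m * |s - t|) * S m := by
      field_simp [(hpos m hm).ne']
    rw [this]
    exact mul_le_mul_of_nonneg_left (hmin ht)
      (mul_nonneg (div_nonneg hlam.le (hpos m hm).le) (abs_nonneg _))
  have h3 := mul_le_mul_of_nonneg_right (Real.add_one_le_exp (lam / S m * |s - t|)) (hpos t ht).le
  linarith

theorem LogLip.one {K : ℝ} (hK : 0 ≤ K) : LogLip K (fun _ => 1) := fun s _ =>
  ⟨one_pos, fun t _ => by
    rw [mul_one]; exact Real.one_le_exp (mul_nonneg hK (abs_nonneg _))⟩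

theorem LogLip.sum {ι : Type*} {K : ℝ} {s : Finset ι} (hs : s.Nonempty) {g : ι → ℝ → ℝ}
    (hg : ∀ i ∈ s, LogLip K (g i)) : LogLip K (fun t => ∑ i ∈ s, g i t) := fun a ha =>
  ⟨Finset.sum_pos (fun i hi => (hg i hi a ha).1) hs, fun b hb => by
    rw [Finset.mul_sum]
    exact Finset.sum_le_sum fun i hi => (hg i hi a ha).2 b hb⟩

theorem LogLip.const_mul {K c : ℝ} (hc : 0 < c) {g : ℝ → ℝ} (hg : LogLip K g) :
    LogLip K (fun t => c * g t) := fun a ha =>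
  ⟨mul_pos hc (hg a ha).1, fun b hb => by
    have := mul_le_mul_of_nonneg_left ((hg a ha).2 b hb) hc.le
    linarith⟩

theorem LogLip.le_mul {K : ℝ} (hK : 0 ≤ K) {g : ℝ → ℝ} (hg : LogLip K g) {s t d : ℝ}
    (hs : s ∈ Icc (0 : ℝ) 1) (ht : t ∈ Icc (0 : ℝ) 1) (hd : |s - t| ≤ d) :
    g s ≤ Real.exp (K * d) * g t :=
  ((hg s hs).2 t ht).trans (mul_le_mul_of_nonneg_right
    (Real.exp_le_exp.2 (mul_le_mul_of_nonneg_left hd hK)) (hg t ht).1.le)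

/-- The constant `K` does not deteriorate: the branches contract by `1 / N ≤ 1 / 2`, so the weight
and `g` contribute at most `K / 2` each. -/
theorem LogLip.transfer {N : ℕ} (hN : 2 ≤ N) {K : ℝ} (hK : 0 ≤ K) {S g : ℝ → ℝ}
    (hS : LogLip K S) (hg : LogLip K g) : LogLip K (transfer N S g) := by
  have hN' : (2 : ℝ) ≤ N := by exact_mod_cast hN
  refine LogLip.sum (Finset.nonempty_range_iff.2 (by omega)) fun i hi => ?_
  have hi := Finset.mem_range.1 hi
  intro a ha
  have ha' := branch_mem hi ha
  refine ⟨mul_pos (hS _ ha').1 (hg _ ha').1, fun b hb => ?_⟩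
  have hb' := branch_mem hi hb
  have hd : |(a + i) / (N : ℝ) - (b + i) / (N : ℝ)| ≤ |a - b| / 2 := by
    rw [abs_branch_sub]
    exact div_le_div_of_nonneg_left (abs_nonneg _) two_pos hN'
  calc S ((a + i) / N) * g ((a + i) / N)
      ≤ (Real.exp (K * (|a - b| / 2)) * S ((b + i) / N)) *
        (Real.exp (K * (|a - b| / 2)) * g ((b + i) / N)) :=
        mul_le_mul (hS.le_mul hK ha' hb' hd) (hg.le_mul hK ha' hb' hd) (hg _ ha').1.le
          (mul_nonneg (Real.exp_pos _).le (hS _ hb').1.le)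
    _ = Real.exp (K * |a - b|) * (S ((b + i) / N) * g ((b + i) / N)) := by
        have : Real.exp (K * |a - b|) =
            Real.exp (K * (|a - b| / 2)) * Real.exp (K * (|a - b| / 2)) := by
          rw [← Real.exp_add]; ring_nf
        rw [this]; ring

theorem transfer_mono {N : ℕ} {S g₁ g₂ : ℝ → ℝ} (hS : ∀ t ∈ Icc (0 : ℝ) 1, 0 < S t)
    (h : ∀ t ∈ Icc (0 : ℝ) 1, g₁ t ≤ g₂ t) {t : ℝ} (ht : t ∈ Icc (0 : ℝ) 1) :
    transfer N S g₁ t ≤ transfer N S g₂ t :=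
  Finset.sum_le_sum fun _ hi =>
    have hm := branch_mem (Finset.mem_range.1 hi) ht
    mul_le_mul_of_nonneg_left (h _ hm) (hS _ hm).le

theorem transfer_const_mul (N : ℕ) (S g : ℝ → ℝ) (c t : ℝ) :
    transfer N S (fun s => c * g s) t = c * transfer N S g t := by
  simp only [transfer, Finset.mul_sum]
  exact Finset.sum_congr rfl fun _ _ => by ring

theorem transfer_sum {ι : Type*} (N : ℕ) (S : ℝ → ℝ) (s : Finset ι) (g : ι → ℝ → ℝ) (t : ℝ) :
    transfer N S (fun u => ∑ k ∈ s, g k u) t = ∑ k ∈ s, transfer N S (g k) t := by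
  simp only [transfer, Finset.mul_sum]
  exact Finset.sum_comm

/-! ### Iterates of the transfer operator and their growth rate -/

/-- The iterates of the transfer operator on the constant function `1`. -/
noncomputable def transferIter (N : ℕ) (S : ℝ → ℝ) : ℕ → ℝ → ℝ
  | 0 => fun _ => 1
  | n + 1 => transfer N S (transferIter N S n)

theorem LogLip.transferIter {N : ℕ} (hN : 2 ≤ N) {K : ℝ} (hK : 0 ≤ K) {S : ℝ → ℝ}
    (hS : LogLip K S) : ∀ n, LogLip K (transferIter N S n)
  | 0 => LogLip.one hK
  | n + 1 => LogLip.transfer hN hK hS (LogLip.transferIter hN hK hS n)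

/-- The operator is positive and linear, so a constant bound for the `m`-th iterate is carried
through `n` further applications. This is the source of subadditivity. -/
theorem transferIter_add_le {N : ℕ} {S : ℝ → ℝ} (hS : ∀ t ∈ Icc (0 : ℝ) 1, 0 < S t) {m : ℕ} {c : ℝ}
    (hc : ∀ t ∈ Icc (0 : ℝ) 1, transferIter N S m t ≤ c) (n : ℕ) :
    ∀ t ∈ Icc (0 : ℝ) 1, transferIter N S (n + m) t ≤ c * transferIter N S n t := by
  induction n with
  | zero => intro t ht; simpa [transferIter] using hc t ht
  | succ n ih =>
    intro t ht
    rw [show n + 1 + m = (n + m) + 1 by omega]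
    exact (transfer_mono hS ih ht).trans (transfer_const_mul N S _ c t).le

theorem pow_le_transferIter {N : ℕ} {S : ℝ → ℝ} (hS : ∀ t ∈ Icc (0 : ℝ) 1, 0 < S t) {c : ℝ}
    (hc0 : 0 ≤ c) (hc : ∀ t ∈ Icc (0 : ℝ) 1, c ≤ transferIter N S 1 t) (n : ℕ) :
    ∀ t ∈ Icc (0 : ℝ) 1, c ^ n ≤ transferIter N S n t := by
  induction n with
  | zero => intro t _; simp [transferIter]
  | succ n ih =>
    intro t ht
    have h1 : transfer N S (fun _ => c ^ n * 1) t ≤ transferIter N S (n + 1) t :=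
      transfer_mono hS (fun s hs => by simpa using ih s hs) ht
    rw [transfer_const_mul N S (fun _ => 1)] at h1
    calc c ^ (n + 1) = c ^ n * c := pow_succ _ _
      _ ≤ c ^ n * transferIter N S 1 t := mul_le_mul_of_nonneg_left (hc t ht) (pow_nonneg hc0 _)
      _ ≤ _ := h1

/-- The truncated resolvent series, used as an approximate eigenfunction of the transfer
operator. -/
noncomputable def approxEigen (N : ℕ) (S : ℝ → ℝ) (r : ℝ) (n : ℕ) (t : ℝ) : ℝ :=
  ∑ k ∈ Finset.range n, (r ^ k)⁻¹ * transferIter N S k t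

/-- The operator shifts the series by one place, so only the two end terms survive. The sign of
`r^{-n} L^n 1 - 1` decides between a sub- and a super-eigenfunction. -/
theorem transfer_approxEigen (N : ℕ) (S : ℝ → ℝ) {r : ℝ} (hr : 0 < r) (n : ℕ) (t : ℝ) :
    transfer N S (approxEigen N S r n) t =
      r * (approxEigen N S r n t + ((r ^ n)⁻¹ * transferIter N S n t - 1)) := by
  have h1 : transfer N S (approxEigen N S r n) t =
      ∑ k ∈ Finset.range n, r * ((r ^ (k + 1))⁻¹ * transferIter N S (k + 1) t) := by
    rw [show approxEigen N S r n = fun u => ∑ k ∈ Finset.range n,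
      (r ^ k)⁻¹ * transferIter N S k u from rfl, transfer_sum]
    refine Finset.sum_congr rfl fun k _ => ?_
    rw [transfer_const_mul]
    simp only [transferIter]
    rw [pow_succ]; field_simp
  rw [h1, ← Finset.mul_sum]
  congr 1
  have h2 := Finset.sum_range_succ' (fun k => (r ^ k)⁻¹ * transferIter N S k t) n
  rw [Finset.sum_range_succ] at h2
  simp only [transferIter, pow_zero, inv_one, mul_one] at h2
  simp only [approxEigen, transferIter]
  linarith

theorem LogLip.approxEigen {N : ℕ} (hN : 2 ≤ N) {K : ℝ} (hK : 0 ≤ K) {S : ℝ → ℝ}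
    (hS : LogLip K S) {r : ℝ} (hr : 0 < r) {n : ℕ} (hn : n ≠ 0) :
    LogLip K (approxEigen N S r n) :=
  LogLip.sum (Finset.nonempty_range_iff.2 hn) fun k _ =>
    (LogLip.transferIter hN hK hS k).const_mul (by positivity)

/-- The growth rate `ρ` of the transfer operator, with sub- and super-eigenfunctions for all numbers
below and above it. -/
theorem exists_growthRate {N : ℕ} (hN : 2 ≤ N) {K : ℝ} (hK : 0 ≤ K) {S : ℝ → ℝ}
    (hS : LogLip K S) {c : ℝ} (hc1 : 1 < c) (hc : ∀ t ∈ Icc (0 : ℝ) 1, c ≤ transferIter N S 1 t) :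
    ∃ ρ : ℝ, c ≤ ρ ∧
      (∀ r, 0 < r → r < ρ → ∃ φ, LogLip K φ ∧ ∀ t ∈ Icc (0 : ℝ) 1, r * φ t ≤ transfer N S φ t) ∧
      (∀ r, ρ < r → ∃ φ, LogLip K φ ∧ ∀ t ∈ Icc (0 : ℝ) 1, transfer N S φ t ≤ r * φ t) := by
  have hSpos : ∀ t ∈ Icc (0 : ℝ) 1, 0 < S t := fun t ht => (hS t ht).1
  have h0 : (0 : ℝ) ∈ Icc (0 : ℝ) 1 := ⟨le_rfl, zero_le_one⟩
  have hc0 : 0 < c := by linarith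
  set A := transferIter N S with hA
  have hAL : ∀ n, LogLip K (A n) := LogLip.transferIter hN hK hS
  have hApos : ∀ n, 0 < A n 0 := fun n => (hAL n 0 h0).1
  have habs : ∀ t ∈ Icc (0 : ℝ) 1, |t - 0| ≤ 1 ∧ |0 - t| ≤ 1 := fun t ht => by
    rw [abs_sub_comm 0 t, sub_zero, abs_of_nonneg ht.1]; exact ⟨ht.2, ht.2⟩
  set D := Real.exp (K * 1) with hD
  have hDpos : 0 < D := Real.exp_pos _
  have hup : ∀ n, ∀ t ∈ Icc (0 : ℝ) 1, A n t ≤ D * A n 0 := fun n t ht =>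
    (hAL n).le_mul hK ht h0 (habs t ht).1
  have hdown : ∀ n, ∀ t ∈ Icc (0 : ℝ) 1, A n 0 ≤ D * A n t := fun n t ht =>
    (hAL n).le_mul hK h0 ht (habs t ht).2
  -- The factor `D` makes the sequence exactly subadditive: `D * A m 0` bounds `A m` on all of `[0,
  -- 1]`.
  set u : ℕ → ℝ := fun n => Real.log (D * A n 0) with hu
  have hsub : Subadditive u := fun m n => by
    have h := transferIter_add_le hSpos (hup n) m 0 h0
    rw [hu]
    simp only
    rw [← Real.log_mul (by have := hApos m; positivity) (by have := hApos n; positivity)]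
    refine Real.log_le_log (mul_pos hDpos (hApos _)) ?_
    have := mul_le_mul_of_nonneg_left h hDpos.le
    rw [← hA] at this
    linarith
  have hgrow : ∀ n, c ^ n ≤ A n 0 := fun n => pow_le_transferIter hSpos hc0.le hc n 0 h0
  have hlow : ∀ n : ℕ, n ≠ 0 → Real.log c ≤ u n / n := fun n hn => by
    have hn' : (0 : ℝ) < n := by positivity
    rw [le_div_iff₀ hn', mul_comm, ← Real.log_pow]
    refine Real.log_le_log (by positivity) ?_
    have : 1 ≤ D := Real.one_le_exp (by linarith)
    nlinarith [hgrow n, hApos n]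
  have hbdd : BddBelow (range fun n => u n / n) := by
    -- For `n = 0` the quotient is `0` by convention; for the other `n` it is at least `log c`, and
    -- `c > 1`.
    refine ⟨0, ?_⟩
    rintro _ ⟨n, rfl⟩
    rcases eq_or_ne n 0 with rfl | hn
    · simp
    · exact (Real.log_nonneg hc1.le).trans (hlow n hn)
  have hlim := hsub.tendsto_lim hbdd
  have hDlim : Tendsto (fun n : ℕ => (2 * Real.log D) / (n : ℝ)) atTop (𝓝 0) :=
    tendsto_const_div_atTop_nhds_zero_nat _
  -- One `log D` undoes the factor in `u`, the other passes from the point `0` to arbitrary `t`;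
  -- both vanish after division by `n`.
  have hlim2 : Tendsto (fun n => u n / n - (2 * Real.log D) / (n : ℝ)) atTop (𝓝 hsub.lim) := by
    simpa using hlim.sub hDlim
  refine ⟨Real.exp hsub.lim, ?_, fun r hr hrρ => ?_, fun r hrρ => ?_⟩
  · rw [← Real.log_le_iff_le_exp hc0]
    refine ge_of_tendsto hlim ?_
    filter_upwards [eventually_ne_atTop 0] with n hn using hlow n hn
  · have hlog : Real.log r < hsub.lim := (Real.log_lt_iff_lt_exp hr).2 hrρ
    obtain ⟨n, hn, hn0⟩ :=
      ((hlim2.eventually_const_lt hlog).and (eventually_ne_atTop 0)).exists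
    refine ⟨approxEigen N S r n, LogLip.approxEigen hN hK hS hr hn0, fun t ht => ?_⟩
    rw [transfer_approxEigen N S hr]
    refine mul_le_mul_of_nonneg_left ?_ hr.le
    have hn' : (0 : ℝ) < n := by positivity
    have hAt : 0 < A n t := (hAL n t ht).1
    have : r ^ n ≤ A n t := by
      rw [← Real.log_le_log_iff (by positivity) hAt, Real.log_pow]
      have h1 : Real.log r * n < u n - 2 * Real.log D := by
        rw [← sub_div] at hn; exact (lt_div_iff₀ hn').1 hn
      have h2 : u n ≤ 2 * Real.log D + Real.log (A n t) := by
        rw [hu, two_mul]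
        simp only
        rw [Real.log_mul hDpos.ne' (hApos n).ne', add_assoc, ← Real.log_mul hDpos.ne' hAt.ne']
        gcongr
        · exact hApos n
        · exact hdown n t ht
      linarith
    have h1 : 1 ≤ (r ^ n)⁻¹ * A n t := by
      rw [← div_eq_inv_mul]; exact (one_le_div (by positivity)).2 this
    linarith
  · have hr : 0 < r := (Real.exp_pos _).trans hrρ
    have hlog : hsub.lim < Real.log r := (Real.lt_log_iff_exp_lt hr).2 hrρ
    obtain ⟨n, hn, hn0⟩ :=
      ((hlim.eventually_lt_const hlog).and (eventually_ne_atTop 0)).exists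
    refine ⟨approxEigen N S r n, LogLip.approxEigen hN hK hS hr hn0, fun t ht => ?_⟩
    rw [transfer_approxEigen N S hr]
    refine mul_le_mul_of_nonneg_left ?_ hr.le
    have hn' : (0 : ℝ) < n := by positivity
    have hAt : 0 < A n t := (hAL n t ht).1
    have : A n t ≤ r ^ n := by
      refine (hup n t ht).trans ?_
      rw [← Real.log_le_log_iff (mul_pos hDpos (hApos n)) (by positivity), Real.log_pow]
      have := (div_lt_iff₀ hn').1 hn
      linarith
    have h1 : (r ^ n)⁻¹ * A n t ≤ 1 := by
      rw [← div_eq_inv_mul]; exact (div_le_one (by positivity)).2 this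
    linarith

/-! ### Spectral radii of nonnegative matrices -/

-- Collatz–Wielandt: an eigenvector `u` for `μ` satisfies `|μ| |u| ≤ A |u|` entrywise; pairing with
-- the positive row vector `v` gives `|μ| ≤ r`.
open Matrix in
theorem specRadius_le_of_vecMul_le {n : ℕ} {A : Matrix (Fin n) (Fin n) ℝ} (hA : ∀ i j, 0 ≤ A i j)
    {v : Fin n → ℝ} (hv : ∀ i, 0 < v i) {r : ℝ} (hr : 0 ≤ r)
    (h : ∀ j, ∑ i, v i * A i j ≤ r * v j) : specRadius A ≤ r := by
  refine ENNReal.toReal_le_of_le_ofReal hr (iSup₂_le fun μ hμ => ?_)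
  change ‖μ‖ₑ ≤ _
  rw [← ofReal_norm]
  refine ENNReal.ofReal_le_ofReal ?_
  have hdet : (algebraMap ℂ (Matrix (Fin n) (Fin n) ℂ) μ - A.map (fun a : ℝ => (a : ℂ))).det = 0 := by
    by_contra hne
    exact hμ ((Matrix.isUnit_iff_isUnit_det _).2 (isUnit_iff_ne_zero.2 hne))
  obtain ⟨u, hu0, hu⟩ := Matrix.exists_mulVec_eq_zero_iff.2 hdet
  have heig : ∀ i, μ * u i = ∑ j, (A i j : ℂ) * u j := fun i => by
    have := congrFun hu i
    rw [Matrix.sub_mulVec, Pi.sub_apply, Pi.zero_apply, sub_eq_zero, Algebra.algebraMap_eq_smul_one,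
      Matrix.smul_mulVec, Matrix.one_mulVec] at this
    simpa [Matrix.mulVec, dotProduct] using this
  have hle : ∀ i, ‖μ‖ * ‖u i‖ ≤ ∑ j, A i j * ‖u j‖ := fun i => by
    rw [← norm_mul, heig]
    refine (norm_sum_le _ _).trans (Finset.sum_le_sum fun j _ => ?_)
    rw [norm_mul, Complex.norm_real, Real.norm_eq_abs, abs_of_nonneg (hA i j)]
  have hpos : 0 < ∑ i, v i * ‖u i‖ := by
    obtain ⟨i, hi⟩ := Function.ne_iff.1 hu0
    exact Finset.sum_pos' (fun j _ => mul_nonneg (hv j).le (norm_nonneg _))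
      ⟨i, Finset.mem_univ _, mul_pos (hv i) (norm_pos_iff.2 hi)⟩
  refine le_of_mul_le_mul_right ?_ hpos
  calc ‖μ‖ * ∑ i, v i * ‖u i‖ = ∑ i, v i * (‖μ‖ * ‖u i‖) := by
        rw [Finset.mul_sum]; exact Finset.sum_congr rfl fun _ _ => by ring
    _ ≤ ∑ i, v i * ∑ j, A i j * ‖u j‖ :=
        Finset.sum_le_sum fun i _ => mul_le_mul_of_nonneg_left (hle i) (hv i).le
    _ = ∑ j, (∑ i, v i * A i j) * ‖u j‖ := by
        simp only [Finset.mul_sum, Finset.sum_mul]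
        rw [Finset.sum_comm]
        exact Finset.sum_congr rfl fun _ _ => Finset.sum_congr rfl fun _ _ => by ring
    _ ≤ ∑ j, (r * v j) * ‖u j‖ :=
        Finset.sum_le_sum fun j _ => mul_le_mul_of_nonneg_right (h j) (norm_nonneg _)
    _ = r * ∑ i, v i * ‖u i‖ := by
        rw [Finset.mul_sum]; exact Finset.sum_congr rfl fun _ _ => by ring

theorem pow_mul_sum_le_of_le_vecMul {n : ℕ} {A : Matrix (Fin n) (Fin n) ℝ} (hA : ∀ i j, 0 ≤ A i j)
    {v : Fin n → ℝ} {r : ℝ} (hr : 0 ≤ r)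
    (h : ∀ j, r * v j ≤ ∑ i, v i * A i j) (m : ℕ) :
    ∀ j, r ^ m * v j ≤ ∑ i, v i * (A ^ m) i j := by
  induction m with
  | zero => intro j; simp [Matrix.one_apply]
  | succ m ih =>
    intro j
    calc r ^ (m + 1) * v j = r ^ m * (r * v j) := by ring
      _ ≤ r ^ m * ∑ i, v i * A i j := mul_le_mul_of_nonneg_left (h j) (pow_nonneg hr _)
      _ = ∑ l, (r ^ m * v l) * A l j := by
          rw [Finset.mul_sum]; exact Finset.sum_congr rfl fun _ _ => by ring
      _ ≤ ∑ l, (∑ i, v i * (A ^ m) i l) * A l j :=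
          Finset.sum_le_sum fun l _ => mul_le_mul_of_nonneg_right (ih l) (hA l j)
      _ = ∑ i, v i * (A ^ (m + 1)) i j := by
          simp only [pow_succ, Matrix.mul_apply, Finset.mul_sum, Finset.sum_mul]
          rw [Finset.sum_comm]
          exact Finset.sum_congr rfl fun _ _ => Finset.sum_congr rfl fun _ _ => by ring

section Gelfand

attribute [local instance] Matrix.linftyOpNormedRing Matrix.linftyOpNormedAlgebra

/-- Iterating the hypothesis and summing over columns, `r^m ∑ v` is at most the `v`-weighted sum of
the row sums of `A^m`. The operator norm for the sup norm dominates each row sum, so `r^m ≤ ‖A^m‖`,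
and Gelfand's formula concludes. -/
theorem le_specRadius_of_le_vecMul {n : ℕ} (hn : 0 < n) {A : Matrix (Fin n) (Fin n) ℝ}
    (hA : ∀ i j, 0 ≤ A i j) {v : Fin n → ℝ} (hv : ∀ i, 0 < v i) {r : ℝ} (hr : 0 ≤ r)
    (h : ∀ j, r * v j ≤ ∑ i, v i * A i j) : r ≤ specRadius A := by
  have : Nonempty (Fin n) := ⟨⟨0, hn⟩⟩
  set B : Matrix (Fin n) (Fin n) ℂ := A.map (fun a : ℝ => (a : ℂ)) with hB
  have hBpow : ∀ m, B ^ m = (A ^ m).map (fun a : ℝ => (a : ℂ)) := fun m =>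
    (map_pow (Complex.ofRealHom.mapMatrix (m := Fin n)) A m).symm
  have hVpos : 0 < ∑ i, v i := Finset.sum_pos (fun i _ => hv i) Finset.univ_nonempty
  have hnorm : ∀ m, r ^ m ≤ ‖B ^ m‖ := fun m => by
    refine le_of_mul_le_mul_right ?_ hVpos
    have hrow : ∀ i, ∑ j, (A ^ m) i j ≤ ‖B ^ m‖ := fun i => by
      have h1 := Matrix.linfty_opNorm_mulVec (B ^ m) (fun _ => (1 : ℂ))
      have h2 := norm_le_pi_norm ((B ^ m).mulVec fun _ => (1 : ℂ)) i
      have h3 : ((B ^ m).mulVec fun _ => (1 : ℂ)) i = ((∑ j, (A ^ m) i j : ℝ) : ℂ) := by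
        rw [hBpow]; simp [Matrix.mulVec, dotProduct]
      rw [h3, Complex.norm_real, Real.norm_eq_abs] at h2
      have h4 : ‖(fun _ : Fin n => (1 : ℂ))‖ = 1 := by simp
      rw [h4, mul_one] at h1
      exact (le_abs_self _).trans (h2.trans h1)
    calc r ^ m * ∑ i, v i = ∑ j, r ^ m * v j := Finset.mul_sum _ _ _
      _ ≤ ∑ j, ∑ i, v i * (A ^ m) i j :=
          Finset.sum_le_sum fun j _ => pow_mul_sum_le_of_le_vecMul hA hr h m j
      _ = ∑ i, v i * ∑ j, (A ^ m) i j := by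
          rw [Finset.sum_comm]; simp only [Finset.mul_sum]
      _ ≤ ∑ i, v i * ‖B ^ m‖ :=
          Finset.sum_le_sum fun i _ => mul_le_mul_of_nonneg_left (hrow i) (hv i).le
      _ = ‖B ^ m‖ * ∑ i, v i := by rw [← Finset.sum_mul, mul_comm]
  have hlim := spectrum.pow_norm_pow_one_div_tendsto_nhds_spectralRadius B
  have hle : ENNReal.ofReal r ≤ spectralRadius ℂ B := by
    refine ge_of_tendsto hlim ?_
    filter_upwards [eventually_ne_atTop 0] with m hm
    refine ENNReal.ofReal_le_ofReal ?_
    rw [one_div]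
    calc r = (r ^ m) ^ ((m : ℝ)⁻¹) := (Real.pow_rpow_inv_natCast hr hm).symm
      _ ≤ _ := Real.rpow_le_rpow (pow_nonneg hr _) (hnorm m) (by positivity)
  have hfin : spectralRadius ℂ B ≠ ⊤ :=
    ((spectrum.spectralRadius_le_nnnorm (𝕜 := ℂ) B).trans_lt ENNReal.coe_lt_top).ne
  exact (ENNReal.ofReal_le_iff_le_toReal hfin).1 hle

end Gelfand

/-! ### Spectral radii of the vertical scaling matrices -/

theorem sum_range_mul_eq (F : ℕ → ℝ) (a b : ℕ) :
    ∑ r ∈ Finset.range (a * b), F r =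
      ∑ i ∈ Finset.range a, ∑ l ∈ Finset.range b, F (i * b + l) := by
  induction a with
  | zero => simp
  | succ a ih => rw [Nat.succ_mul, Finset.sum_range_add, ih, Finset.sum_range_succ]

/-- Column `j` has one possibly nonzero entry for each branch `i`, in the row of the cell that
contains the image of the `j`-th cell under that branch. A row vector times the matrix is thus a
discretized transfer operator. -/
theorem sum_mul_scaleMatrix {N : ℕ} (hN : 0 < N) (k : ℕ) (s : ℕ → ℕ → ℝ) (g : ℕ → ℝ)
    (j : Fin (N ^ (k + 1))) :
    ∑ r : Fin (N ^ (k + 1)), g r * scaleMatrix N (k + 1) s r j =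
      ∑ i ∈ Finset.range N, g (i * N ^ k + j / N) * s i j := by
  obtain ⟨j, hj⟩ := j
  have hjl : j / N < N ^ k := Nat.div_lt_of_lt_mul (by rw [← pow_succ']; exact hj)
  have hmod : ∀ i l, l < N ^ k → (i * N ^ k + l) % N ^ k = l := fun i l hl => by
    rw [Nat.mul_add_mod_self_right, Nat.mod_eq_of_lt hl]
  have hdiv : ∀ i l, l < N ^ k → (i * N ^ k + l) / N ^ k = i := fun i l hl => by
    rw [mul_comm, Nat.mul_add_div (by positivity), Nat.div_eq_of_lt hl, add_zero]
  have h1 := Fin.sum_univ_eq_sum_range (fun r => g r * (if (r % N ^ k) * N ≤ j ∧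
    j < (r % N ^ k + 1) * N then s (r / N ^ k) j else 0)) (N ^ (k + 1))
  refine Eq.trans ?_ (h1.trans ?_)
  · rfl
  · change _ = ∑ i ∈ Finset.range N, g (i * N ^ k + j / N) * s i j
    clear h1
    rw [pow_succ', sum_range_mul_eq]
    refine Finset.sum_congr rfl fun i _ => ?_
    rw [Finset.sum_eq_single (j / N)]
    · rw [hmod i _ hjl, hdiv i _ hjl, if_pos]
      exact ⟨Nat.div_mul_le_self _ _, by rw [mul_comm]; exact Nat.lt_mul_div_succ _ hN⟩
    · intro l hl hne
      have hl := Finset.mem_range.1 hl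
      rw [hmod i l hl, if_neg, mul_zero]
      rintro ⟨h1, h2⟩
      exact hne (Nat.div_eq_of_lt_le h1 h2).symm
    · intro h; exact absurd (Finset.mem_range.2 hjl) h

theorem node_mem {N : ℕ} (hN : 0 < N) {k j : ℕ} (hj : j < N ^ k) :
    (j : ℝ) / (N : ℝ) ^ k ∈ Icc (0 : ℝ) 1 := by
  have hN' : (0 : ℝ) < N := by exact_mod_cast hN
  exact ⟨by positivity, (div_le_one (by positivity)).2 (by exact_mod_cast hj.le)⟩

/-- The left end point of the cell of level `k` containing the node `(j / N ^ k + i) / N` of level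
`k + 1` is close to that node. -/
theorem abs_parent_sub_le {N : ℕ} (hN : 0 < N) (k i j : ℕ) :
    |((i * N ^ k + j / N : ℕ) : ℝ) / (N : ℝ) ^ (k + 1) -
      ((j : ℝ) / (N : ℝ) ^ (k + 1) + i) / N| ≤ 1 / (N : ℝ) ^ (k + 1) := by
  have hN' : (0 : ℝ) < N := by exact_mod_cast hN
  have hdm : (N : ℝ) * (j / N : ℕ) + (j % N : ℕ) = j := by exact_mod_cast Nat.div_add_mod j N
  have hm : ((j % N : ℕ) : ℝ) ≤ N := by exact_mod_cast (Nat.mod_lt j hN).le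
  have h : ((i * N ^ k + j / N : ℕ) : ℝ) / (N : ℝ) ^ (k + 1) -
      ((j : ℝ) / (N : ℝ) ^ (k + 1) + i) / N = -((j % N : ℕ) / N / (N : ℝ) ^ (k + 1)) := by
    rw [← hdm]
    generalize (j / N) = q
    generalize (j % N) = m
    push_cast
    field_simp
    ring
  rw [h, abs_neg, abs_of_nonneg (by positivity)]
  gcongr
  exact (div_le_one hN').2 hm

/-- The point subtracted is the left end point of the cell. The width is really `1 / N^(k+1)`; the
cruder bound is enough. -/
theorem cell_subset {N : ℕ} {k i j : ℕ} (hi : i < N) (hj : j < N ^ k) {s : ℝ}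
    (hs : s ∈ cell N k i j) :
    s ∈ Icc (0 : ℝ) 1 ∧ |s - ((j : ℝ) / (N : ℝ) ^ k + i) / N| ≤ 1 / (N : ℝ) ^ k := by
  have hN' : (1 : ℝ) ≤ N := by exact_mod_cast (by omega : 1 ≤ N)
  have hN0 : (0 : ℝ) < N := by linarith
  have hi' : (i : ℝ) + 1 ≤ N := by exact_mod_cast hi
  have hj' : (j : ℝ) + 1 ≤ (N : ℝ) ^ k := by exact_mod_cast hj
  have hlen : ((i : ℝ) + 1) / N - i / N = 1 / N := by ring
  rw [cell, subInterval, hlen] at hs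
  obtain ⟨h1, h2⟩ := hs
  have e1 : (i : ℝ) / N + j / (N : ℝ) ^ k * (1 / N) = ((j : ℝ) / (N : ℝ) ^ k + i) / N := by ring
  have e2 : (i : ℝ) / N + (j + 1) / (N : ℝ) ^ k * (1 / N) =
      ((j : ℝ) / (N : ℝ) ^ k + i) / N + 1 / (N : ℝ) ^ k / N := by ring
  have h3 : 1 / (N : ℝ) ^ k / N ≤ 1 / (N : ℝ) ^ k := div_le_self (by positivity) hN'
  have h4 : (i : ℝ) / N + (j + 1) / (N : ℝ) ^ k * (1 / N) ≤ 1 := by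
    have : ((j : ℝ) + 1) / (N : ℝ) ^ k ≤ 1 := (div_le_one (by positivity)).2 hj'
    calc (i : ℝ) / N + (j + 1) / (N : ℝ) ^ k * (1 / N) ≤ i / N + 1 * (1 / N) := by gcongr
      _ = (i + 1) / N := by ring
      _ ≤ 1 := (div_le_one hN0).2 hi'
  have h5 : (0 : ℝ) ≤ (i : ℝ) / N + j / (N : ℝ) ^ k * (1 / N) := by positivity
  refine ⟨⟨h5.trans h1, h2.trans h4⟩, ?_⟩
  rw [abs_le]
  constructor <;> linarith

/-- The entries `s i j` of a scale matrix of level `k` are comparable to the values of `S`, up to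
the factor `exp (K / N ^ k)`. -/
def ScaleApprox (N : ℕ) (K : ℝ) (S : ℝ → ℝ) (k : ℕ) (s : ℕ → ℕ → ℝ) : Prop :=
  ∀ i < N, ∀ j < N ^ k,
    S (((j : ℝ) / (N : ℝ) ^ k + i) / N) ≤ Real.exp (K * (1 / (N : ℝ) ^ k)) * s i j ∧
    s i j ≤ Real.exp (K * (1 / (N : ℝ) ^ k)) * S (((j : ℝ) / (N : ℝ) ^ k + i) / N)

theorem cell_nonempty {N : ℕ} (hN : 0 < N) (k i j : ℕ) : (cell N k i j).Nonempty := by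
  have hlen : ((i : ℝ) + 1) / N - i / N = 1 / N := by ring
  rw [cell, subInterval, hlen, nonempty_Icc]
  have : (0 : ℝ) < N := by exact_mod_cast hN
  gcongr
  linarith

theorem abs_bounds_on_cell {N : ℕ} {K : ℝ} (hK : 0 ≤ K) {S : ℝ → ℝ}
    (hS : LogLip K S) {k i j : ℕ} (hi : i < N) (hj : j < N ^ k) {s : ℝ} (hs : s ∈ cell N k i j) :
    S (((j : ℝ) / (N : ℝ) ^ k + i) / N) ≤ Real.exp (K * (1 / (N : ℝ) ^ k)) * |S s| ∧
    |S s| ≤ Real.exp (K * (1 / (N : ℝ) ^ k)) * S (((j : ℝ) / (N : ℝ) ^ k + i) / N) := by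
  have hp := branch_mem hi (node_mem (by omega : 0 < N) hj)
  obtain ⟨h1, h2⟩ := cell_subset hi hj hs
  rw [abs_of_pos (hS s h1).1]
  exact ⟨hS.le_mul hK hp h1 (by rwa [abs_sub_comm]), hS.le_mul hK h1 hp h2⟩

theorem scaleApprox_upper {N : ℕ} {K : ℝ} (hK : 0 ≤ K) {S : ℝ → ℝ}
    (hS : LogLip K S) (k : ℕ) : ScaleApprox N K S k (upperScale N S k) := by
  intro i hi j hj
  obtain ⟨p, hp⟩ := cell_nonempty (by omega : 0 < N) k i j
  have hb : ∀ r ∈ (fun x => |S x|) '' cell N k i j,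
      r ≤ Real.exp (K * (1 / (N : ℝ) ^ k)) * S (((j : ℝ) / (N : ℝ) ^ k + i) / N) := by
    rintro _ ⟨s, hs, rfl⟩
    exact (abs_bounds_on_cell hK hS hi hj hs).2
  exact ⟨(abs_bounds_on_cell hK hS hi hj hp).1.trans (mul_le_mul_of_nonneg_left
    (le_csSup ⟨_, hb⟩ ⟨p, hp, rfl⟩) (Real.exp_pos _).le), csSup_le ⟨_, p, hp, rfl⟩ hb⟩

theorem scaleApprox_lower {N : ℕ} {K : ℝ} (hK : 0 ≤ K) {S : ℝ → ℝ}
    (hS : LogLip K S) (k : ℕ) : ScaleApprox N K S k (lowerScale N S k) := by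
  intro i hi j hj
  obtain ⟨p, hp⟩ := cell_nonempty (by omega : 0 < N) k i j
  have hexp := Real.exp_pos (K * (1 / (N : ℝ) ^ k))
  have hb : ∀ r ∈ (fun x => |S x|) '' cell N k i j,
      S (((j : ℝ) / (N : ℝ) ^ k + i) / N) / Real.exp (K * (1 / (N : ℝ) ^ k)) ≤ r := by
    rintro _ ⟨s, hs, rfl⟩
    rw [div_le_iff₀' hexp]
    exact (abs_bounds_on_cell hK hS hi hj hs).1
  refine ⟨?_, (csInf_le ⟨_, hb⟩ ⟨p, hp, rfl⟩).trans (abs_bounds_on_cell hK hS hi hj hp).2⟩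
  rw [← div_le_iff₀' hexp]
  exact le_csInf ⟨_, p, hp, rfl⟩ hb

theorem ScaleApprox.nonneg {N : ℕ} {K : ℝ} {S : ℝ → ℝ} (hS : LogLip K S) {k : ℕ}
    {s : ℕ → ℕ → ℝ} (hs : ScaleApprox N K S k s) {i j : ℕ} (hi : i < N) (hj : j < N ^ k) :
    0 ≤ s i j := by
  have hp := branch_mem hi (node_mem (by omega : 0 < N) hj)
  have h := (hS _ hp).1.le.trans (hs i hi j hj).1
  exact nonneg_of_mul_nonneg_right h (Real.exp_pos _)

theorem ScaleApprox.matrix_nonneg {N : ℕ} {K : ℝ} {S : ℝ → ℝ} (hS : LogLip K S) {k : ℕ}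
    {s : ℕ → ℕ → ℝ} (hs : ScaleApprox N K S (k + 1) s) (r j : Fin (N ^ (k + 1))) :
    0 ≤ scaleMatrix N (k + 1) s r j := by
  simp only [scaleMatrix, Matrix.of_apply]
  split_ifs
  · exact hs.nonneg hS (Nat.div_lt_of_lt_mul (by
      rw [Nat.add_sub_cancel, ← pow_succ]; exact r.2)) j.2
  · exact le_rfl

theorem child_lt {N k i j : ℕ} (hi : i < N) (hj : j < N ^ k) : i * N ^ k + j < N ^ (k + 1) :=
  calc i * N ^ k + j < (i + 1) * N ^ k := by rw [add_mul, one_mul]; omega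
    _ ≤ N * N ^ k := Nat.mul_le_mul_right _ hi
    _ = N ^ (k + 1) := (pow_succ' _ _).symm

theorem parent_lt {N k i j : ℕ} (hi : i < N) (hj : j < N ^ (k + 1)) :
    i * N ^ k + j / N < N ^ (k + 1) :=
  child_lt hi (Nat.div_lt_of_lt_mul (by rw [← pow_succ']; exact hj))

theorem exp_mul_two (x : ℝ) : Real.exp (2 * x) = Real.exp x * Real.exp x := by
  rw [← Real.exp_add, two_mul]

/-- The test vector samples `φ` at left end points. One factor `E` pays for replacing matrix entries
by values of `S`, the other for moving the argument of `φ` to the branch point. -/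
theorem specRadius_scaleMatrix_le {N : ℕ} (hN : 0 < N) {K : ℝ} (hK : 0 ≤ K) {S φ : ℝ → ℝ}
    (hS : LogLip K S) (hφ : LogLip K φ) {r : ℝ} (hr : 0 ≤ r)
    (h : ∀ t ∈ Icc (0 : ℝ) 1, transfer N S φ t ≤ r * φ t) {k : ℕ} {s : ℕ → ℕ → ℝ}
    (hs : ScaleApprox N K S (k + 1) s) :
    specRadius (scaleMatrix N (k + 1) s) ≤ Real.exp (2 * (K * (1 / (N : ℝ) ^ (k + 1)))) * r := by
  set E := Real.exp (K * (1 / (N : ℝ) ^ (k + 1))) with hE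
  have hE0 : 0 < E := Real.exp_pos _
  rw [exp_mul_two, ← hE]
  refine specRadius_le_of_vecMul_le (hs.matrix_nonneg hS)
    (v := fun j => φ ((j : ℕ) / (N : ℝ) ^ (k + 1)))
    (fun j => (hφ _ (node_mem hN j.2)).1) (by positivity) fun j => ?_
  rw [sum_mul_scaleMatrix hN k s (fun j => φ ((j : ℕ) / (N : ℝ) ^ (k + 1))) j]
  have hj := node_mem hN j.2
  calc _ ≤ ∑ i ∈ Finset.range N, (E * φ (((j : ℕ) / (N : ℝ) ^ (k + 1) + i) / N)) *
        (E * S (((j : ℕ) / (N : ℝ) ^ (k + 1) + i) / N)) := by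
        refine Finset.sum_le_sum fun i hi => ?_
        have hi := Finset.mem_range.1 hi
        have hp := branch_mem hi hj
        exact mul_le_mul (hφ.le_mul hK (node_mem hN (parent_lt hi j.2)) hp
          (abs_parent_sub_le hN k i j)) (hs i hi j j.2).2 (hs.nonneg hS hi j.2)
          (mul_nonneg hE0.le (hφ _ hp).1.le)
    _ = E * E * transfer N S φ ((j : ℕ) / (N : ℝ) ^ (k + 1)) := by
        rw [transfer, Finset.mul_sum]
        exact Finset.sum_congr rfl fun _ _ => by ring
    _ ≤ E * E * (r * φ ((j : ℕ) / (N : ℝ) ^ (k + 1))) :=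
        mul_le_mul_of_nonneg_left (h _ hj) (by positivity)
    _ = _ := by ring

theorem le_specRadius_scaleMatrix {N : ℕ} (hN : 0 < N) {K : ℝ} (hK : 0 ≤ K) {S φ : ℝ → ℝ}
    (hS : LogLip K S) (hφ : LogLip K φ) {r : ℝ} (hr : 0 ≤ r)
    (h : ∀ t ∈ Icc (0 : ℝ) 1, r * φ t ≤ transfer N S φ t) {k : ℕ} {s : ℕ → ℕ → ℝ}
    (hs : ScaleApprox N K S (k + 1) s) :
    r / Real.exp (2 * (K * (1 / (N : ℝ) ^ (k + 1)))) ≤ specRadius (scaleMatrix N (k + 1) s) := by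
  set E := Real.exp (K * (1 / (N : ℝ) ^ (k + 1))) with hE
  have hE0 : 0 < E := Real.exp_pos _
  rw [exp_mul_two, ← hE]
  refine le_specRadius_of_le_vecMul (by positivity) (hs.matrix_nonneg hS)
    (v := fun j => φ ((j : ℕ) / (N : ℝ) ^ (k + 1)))
    (fun j => (hφ _ (node_mem hN j.2)).1) (by positivity) fun j => ?_
  rw [sum_mul_scaleMatrix hN k s (fun j => φ ((j : ℕ) / (N : ℝ) ^ (k + 1))) j, div_mul_eq_mul_div,
    div_le_iff₀' (by positivity)]
  have hj := node_mem hN j.2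
  refine (h _ hj).trans ?_
  rw [transfer, Finset.mul_sum]
  refine Finset.sum_le_sum fun i hi => ?_
  have hi := Finset.mem_range.1 hi
  have hp := branch_mem hi hj
  have hq := node_mem hN (parent_lt hi j.2)
  have h1 := hφ.le_mul hK hp hq ((abs_sub_comm _ _).trans_le (abs_parent_sub_le hN k i j))
  calc _ ≤ (E * s i j) * (E * φ ((i * N ^ k + j / N : ℕ) / (N : ℝ) ^ (k + 1))) :=
        mul_le_mul (hs i hi j j.2).1 h1 (hφ _ hp).1.le
          (mul_nonneg hE0.le (hs.nonneg hS hi j.2))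
    _ = _ := by ring

/-- Spectral radii of scale matrices that approximate `S` converge to the growth rate of the
transfer operator. -/
theorem tendsto_specRadius_scaleMatrix {N : ℕ} (hN : 2 ≤ N) {K : ℝ} (hK : 0 ≤ K) {S : ℝ → ℝ}
    (hS : LogLip K S) {ρ : ℝ} (hρ : 0 < ρ)
    (hlow : ∀ r, 0 < r → r < ρ →
      ∃ φ, LogLip K φ ∧ ∀ t ∈ Icc (0 : ℝ) 1, r * φ t ≤ transfer N S φ t)
    (hup : ∀ r, ρ < r → ∃ φ, LogLip K φ ∧ ∀ t ∈ Icc (0 : ℝ) 1, transfer N S φ t ≤ r * φ t)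
    {s : ℕ → ℕ → ℕ → ℝ} (hs : ∀ k, ScaleApprox N K S k (s k)) :
    Tendsto (fun k => specRadius (scaleMatrix N k (s k))) atTop (𝓝 ρ) := by
  have hN0 : 0 < N := by omega
  have hN1 : (1 : ℝ) < N := by exact_mod_cast (by omega : 1 < N)
  have hE : Tendsto (fun k : ℕ => Real.exp (2 * (K * (1 / (N : ℝ) ^ (k + 1))))) atTop (𝓝 1) := by
    have h1 : Tendsto (fun k : ℕ => 1 / (N : ℝ) ^ (k + 1)) atTop (𝓝 0) := by
      simp only [one_div]
      exact tendsto_inv_atTop_zero.comp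
        ((tendsto_pow_atTop_atTop_of_one_lt hN1).comp (tendsto_add_atTop_nat 1))
    have h2 := (Real.continuous_exp.tendsto _).comp ((h1.const_mul K).const_mul 2)
    simpa [Function.comp_def] using h2
  -- Level `0` is dropped, since `scaleMatrix` involves `k - 1`.
  rw [← tendsto_add_atTop_iff_nat 1, tendsto_order]
  constructor
  · intro a ha
    -- The maximum with `0` keeps `r` positive, as `hlow` requires.
    obtain ⟨r, hr1, hr2⟩ := exists_between (max_lt ha hρ)
    have hr0 : 0 < r := (le_max_right _ _).trans_lt hr1
    obtain ⟨φ, hφ, h⟩ := hlow r hr0 hr2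
    have hlim : Tendsto (fun k : ℕ => r / Real.exp (2 * (K * (1 / (N : ℝ) ^ (k + 1))))) atTop
        (𝓝 r) := by
      simpa [Pi.div_def] using (tendsto_const_nhds (x := r)).div hE one_ne_zero
    filter_upwards [hlim.eventually_const_lt ((le_max_left _ _).trans_lt hr1)] with k hk
    exact hk.trans_le (le_specRadius_scaleMatrix hN0 hK hS hφ hr0.le h (hs (k + 1)))
  · intro a ha
    obtain ⟨r, hr1, hr2⟩ := exists_between ha
    obtain ⟨φ, hφ, h⟩ := hup r hr1
    have hlim : Tendsto (fun k : ℕ => Real.exp (2 * (K * (1 / (N : ℝ) ^ (k + 1)))) * r) atTop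
        (𝓝 r) := by simpa using hE.mul_const r
    filter_upwards [hlim.eventually_lt_const hr2] with k hk
    exact (specRadius_scaleMatrix_le hN0 hK hS hφ (hρ.trans hr1).le h (hs (k + 1))).trans_lt hk

/-! ### The functional equation -/

/-- `f` satisfies `f ((t + i) / N) = S ((t + i) / N) * f t + a i + d i * t` on `[0, 1]` for
`i < N`. -/
def SelfAffine (N : ℕ) (S f : ℝ → ℝ) (a d : ℕ → ℝ) : Prop :=
  ∀ i < N, ∀ t ∈ Icc (0 : ℝ) 1,
    f ((t + i) / N) = S ((t + i) / N) * f t + (a i + d i * t)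

theorem unifNodes_zero (N : ℕ) : unifNodes N 0 = 0 := by simp [unifNodes]

theorem unifNodes_last {N : ℕ} (hN : 0 < N) : unifNodes N (Fin.last N) = 1 := by
  have : (N : ℝ) ≠ 0 := by exact_mod_cast hN.ne'
  simp [unifNodes, div_self this]

theorem strictMono_unifNodes {N : ℕ} (hN : 0 < N) : StrictMono (unifNodes N) := fun i j hij => by
  have : (0 : ℝ) < N := by exact_mod_cast hN
  have hij' : ((i : ℕ) : ℝ) < (j : ℕ) := by exact_mod_cast hij
  exact div_lt_div_of_pos_right hij' this

theorem nodeMap_unifNodes {N : ℕ} (i : Fin N) (t : ℝ) :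
    nodeMap (unifNodes N) i t = (t + (i : ℕ)) / N := by
  have hN : 0 < N := i.pos
  rw [nodeMap, unifNodes_zero, unifNodes_last hN]
  simp only [chord, unifNodes, Fin.val_succ, Fin.val_castSucc]
  push_cast
  ring

theorem sumFun_eq {N : ℕ} {S : ℝ → ℝ} (hS : ∀ t ∈ Icc (0 : ℝ) 1, 0 < S t) {t : ℝ}
    (ht : t ∈ Icc (0 : ℝ) 1) : sumFun N S t = ∑ i ∈ Finset.range N, S ((t + i) / N) := by
  rw [← Fin.sum_univ_eq_sum_range (fun i : ℕ => S ((t + i) / N))]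
  refine Finset.sum_congr rfl fun i _ => ?_
  rw [nodeMap_unifNodes, abs_of_pos (hS _ (branch_mem i.2 ht))]

theorem gammaMin_le {N : ℕ} {S : ℝ → ℝ} (hS : ∀ t ∈ Icc (0 : ℝ) 1, 0 < S t) {t : ℝ}
    (ht : t ∈ Icc (0 : ℝ) 1) : gammaMin N S ≤ ∑ i ∈ Finset.range N, S ((t + i) / N) := by
  rw [← sumFun_eq hS ht]
  refine csInf_le ⟨0, ?_⟩ ⟨t, ht, rfl⟩
  rintro _ ⟨s, _, rfl⟩
  exact Finset.sum_nonneg fun _ _ => abs_nonneg _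

/-- The point `W_i(t, f t)` lies on the graph, so its second coordinate is the value of `f` at its
first. The base line vanishes, and the slopes `d i = y_{i+1} - y_i` telescope to `y_N - y_0 = 0`. -/
theorem IsGenAffineFIF.selfAffine {N : ℕ} (hN : 0 < N) {y : Fin (N + 1) → ℝ} (hy0 : y 0 = 0)
    (hyN : y (Fin.last N) = 0) {S f : ℝ → ℝ} (hf : IsGenAffineFIF (unifNodes N) y S f) :
    ∃ a d : ℕ → ℝ, SelfAffine N S f a d ∧ ∑ i ∈ Finset.range N, d i = 0 := by
  have hN' : (0 : ℝ) < N := by exact_mod_cast hN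
  -- The default `0` is never met: only indices up to `N` occur.
  let Y : ℕ → ℝ := fun n => if h : n < N + 1 then y ⟨n, h⟩ else 0
  refine ⟨Y, fun i => Y (i + 1) - Y i, fun i hi t ht => ?_, ?_⟩
  · have hinv := hf.invariant
    rw [unifNodes_zero, unifNodes_last hN] at hinv
    have hmem : ifsMap (unifNodes N) y S ⟨i, hi⟩ (t, f t) ∈ graphOver f 0 1 := by
      rw [hinv]
      exact mem_iUnion.2 ⟨⟨i, hi⟩, (t, f t), ⟨t, ht, rfl⟩, rfl⟩
    obtain ⟨u, -, hu⟩ := hmem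
    simp only [ifsMap, vertMap, nodeMap_unifNodes, Prod.mk.injEq] at hu
    obtain ⟨rfl, hu⟩ := hu
    have hbase : baseLine (unifNodes N) y t = 0 := by simp [baseLine, chord, hy0, hyN]
    have hmem : (t + i) / (N : ℝ) ∈ Icc (unifNodes N (Fin.castSucc ⟨i, hi⟩))
        (unifNodes N (Fin.succ ⟨i, hi⟩)) := by
      simp only [unifNodes, Fin.val_succ, Fin.val_castSucc]
      push_cast
      constructor
      · exact div_le_div_of_nonneg_right (by linarith [ht.1]) hN'.le
      · exact div_le_div_of_nonneg_right (by linarith [ht.2]) hN'.le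
    have hpoly := polyline_eq_chord (strictMono_unifNodes hN) y ⟨i, hi⟩ hmem
    have hY0 : Y i = y (Fin.castSucc ⟨i, hi⟩) := dif_pos (by omega)
    have hY1 : Y (i + 1) = y (Fin.succ ⟨i, hi⟩) := dif_pos (by omega)
    beta_reduce
    rw [hu, hbase, sub_zero, hpoly, hY0, hY1]
    congr 1
    simp only [chord, unifNodes, Fin.val_succ, Fin.val_castSucc]
    congr 2
    push_cast
    have : ((i : ℝ) + 1) / N - i / N = 1 / N := by ring
    rw [this]
    field_simp
    ring
  · rw [Finset.sum_range_sub]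
    have h1 : Y N = y (Fin.last N) := dif_pos (by omega)
    have h0 : Y 0 = y 0 := dif_pos (by omega)
    rw [h1, h0, hy0, hyN, sub_zero]

/-! ### Oscillations -/

theorem abs_sub_le_osc {g : ℝ → ℝ} {U : Set ℝ} (hU : IsCompact U) (hg : ContinuousOn g U) {s t : ℝ}
    (hs : s ∈ U) (ht : t ∈ U) : |g s - g t| ≤ osc g U := by
  obtain ⟨C, hC⟩ := hU.exists_bound_of_continuousOn hg
  refine le_csSup ⟨C + C, ?_⟩ ⟨s, hs, t, ht, rfl⟩
  rintro _ ⟨s, hs, t, ht, rfl⟩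
  exact (abs_sub _ _).trans (add_le_add (hC s hs) (hC t ht))

theorem osc_le {g : ℝ → ℝ} {U : Set ℝ} (hne : U.Nonempty) {c : ℝ}
    (h : ∀ s ∈ U, ∀ t ∈ U, |g s - g t| ≤ c) : osc g U ≤ c := by
  obtain ⟨s, hs⟩ := hne
  refine csSup_le ⟨_, s, hs, s, hs, rfl⟩ ?_
  rintro _ ⟨s, hs, t, ht, rfl⟩
  exact h s hs t ht

theorem exists_osc_eq {g : ℝ → ℝ} {U : Set ℝ} (hU : IsCompact U) (hne : U.Nonempty)
    (hg : ContinuousOn g U) : ∃ s ∈ U, ∃ t ∈ U, osc g U = g s - g t ∧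
      ∀ u ∈ U, g u ∈ Icc (g t) (g s) := by
  obtain ⟨s, hs, hmax⟩ := hU.exists_isMaxOn hne hg
  obtain ⟨t, ht, hmin⟩ := hU.exists_isMinOn hne hg
  refine ⟨s, hs, t, ht, le_antisymm (osc_le hne fun u hu v hv => ?_) ?_, fun u hu =>
    ⟨hmin hu, hmax hu⟩⟩
  · have h1 : g u ≤ g s := hmax hu
    have h2 : g v ≤ g s := hmax hv
    have h3 : g t ≤ g u := hmin hu
    have h4 : g t ≤ g v := hmin hv
    rw [abs_le]; constructor <;> linarith
  · exact (le_abs_self _).trans (abs_sub_le_osc hU hg hs ht)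

theorem osc_nonneg (g : ℝ → ℝ) (U : Set ℝ) : 0 ≤ osc g U :=
  Real.sSup_nonneg (by rintro _ ⟨s, _, t, _, rfl⟩; exact abs_nonneg _)

theorem subInterval_unit (N k j : ℕ) :
    subInterval N 0 1 k j = Icc ((j : ℝ) / (N : ℝ) ^ k) (((j : ℝ) + 1) / (N : ℝ) ^ k) := by
  simp [subInterval]

theorem isCompact_subInterval (N k j : ℕ) : IsCompact (subInterval N 0 1 k j) := isCompact_Icc

theorem left_mem_subInterval (N k j : ℕ) :
    (j : ℝ) / (N : ℝ) ^ k ∈ subInterval N 0 1 k j := by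
  rw [subInterval_unit, left_mem_Icc]
  gcongr; linarith

theorem subInterval_subset {N k j : ℕ} (hN : 0 < N) (hj : j < N ^ k) :
    subInterval N 0 1 k j ⊆ Icc 0 1 := by
  have hN' : (0 : ℝ) < N := by exact_mod_cast hN
  rw [subInterval_unit]
  refine Icc_subset_Icc (by positivity) ((div_le_one (by positivity)).2 ?_)
  exact_mod_cast hj

theorem abs_sub_le_of_mem_subInterval {N k j : ℕ} {s t : ℝ} (hs : s ∈ subInterval N 0 1 k j)
    (ht : t ∈ subInterval N 0 1 k j) : |s - t| ≤ 1 / (N : ℝ) ^ k := by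
  rw [subInterval_unit, add_div] at hs ht
  rw [abs_le]
  constructor <;> linarith [hs.1, hs.2, ht.1, ht.2]

theorem branch_mem_subInterval {N : ℕ} (hN : 0 < N) {k i j : ℕ} {t : ℝ} :
    (t + i) / (N : ℝ) ∈ subInterval N 0 1 (k + 1) (i * N ^ k + j) ↔ t ∈ subInterval N 0 1 k j := by
  have hN' : (0 : ℝ) < N := by exact_mod_cast hN
  have e1 : ((i * N ^ k + j : ℕ) : ℝ) / (N : ℝ) ^ (k + 1) = ((j : ℝ) / (N : ℝ) ^ k + i) / N := by
    push_cast; field_simp; ring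
  have e2 : (((i * N ^ k + j : ℕ) : ℝ) + 1) / (N : ℝ) ^ (k + 1) =
      (((j : ℝ) + 1) / (N : ℝ) ^ k + i) / N := by
    push_cast; field_simp; ring
  rw [subInterval_unit, subInterval_unit, e1, e2, mem_Icc, mem_Icc,
    div_le_div_iff_of_pos_right hN', div_le_div_iff_of_pos_right hN']
  simp

theorem exists_branch_eq {N : ℕ} (hN : 0 < N) {k i j : ℕ} {u : ℝ}
    (hu : u ∈ subInterval N 0 1 (k + 1) (i * N ^ k + j)) :
    ∃ t ∈ subInterval N 0 1 k j, u = (t + i) / N := by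
  have hN' : (N : ℝ) ≠ 0 := by exact_mod_cast hN.ne'
  have h : u = ((N * u - i) + i) / N := by field_simp; ring
  exact ⟨N * u - i, (branch_mem_subInterval hN).1 (h ▸ hu), h⟩

/-- Cells are grouped by branch: number `i * N^k + j` is the image of the `j`-th cell of level `k`
under branch `i`, not a subinterval of it. -/
theorem oscSum_succ (N : ℕ) (g : ℝ → ℝ) (k : ℕ) :
    oscSum N g 0 1 (k + 1) = ∑ i ∈ Finset.range N, ∑ j ∈ Finset.range (N ^ k),
      osc g (subInterval N 0 1 (k + 1) (i * N ^ k + j)) := by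
  rw [oscSum, pow_succ', sum_range_mul_eq]

theorem abs_le_maxAbs {f : ℝ → ℝ} (hf : ContinuousOn f (Icc 0 1)) {t : ℝ}
    (ht : t ∈ Icc (0 : ℝ) 1) : |f t| ≤ maxAbs f := by
  obtain ⟨C, hC⟩ := isCompact_Icc.exists_bound_of_continuousOn hf
  refine le_csSup ⟨C, ?_⟩ ⟨t, ht, rfl⟩
  rintro _ ⟨s, hs, rfl⟩
  exact hC s hs

/-- Summing the increments over all branches first removes the contribution of the piecewise linear
part. -/
theorem oscSum_succ_ge {N : ℕ} (hN : 0 < N) {S f : ℝ → ℝ} {lam : ℝ}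
    (hSlip : ∀ s ∈ Icc (0 : ℝ) 1, ∀ t ∈ Icc (0 : ℝ) 1, |S s - S t| ≤ lam * |s - t|)
    (hSpos : ∀ t ∈ Icc (0 : ℝ) 1, 0 < S t) (hlam : 0 ≤ lam) (hf : ContinuousOn f (Icc 0 1))
    {a d : ℕ → ℝ} (haff : SelfAffine N S f a d) (hd : ∑ i ∈ Finset.range N, d i = 0) (k : ℕ) :
    gammaMin N S * oscSum N f 0 1 k - lam * maxAbs f ≤ oscSum N f 0 1 (k + 1) := by
  have hN' : (0 : ℝ) < N := by exact_mod_cast hN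
  have hM : 0 ≤ maxAbs f := (abs_nonneg _).trans (abs_le_maxAbs hf ⟨le_rfl, zero_le_one⟩)
  rw [oscSum_succ, Finset.sum_comm]
  have hcell : ∀ j ∈ Finset.range (N ^ k),
      gammaMin N S * osc f (subInterval N 0 1 k j) - lam * maxAbs f * (1 / (N : ℝ) ^ k) ≤
      ∑ i ∈ Finset.range N, osc f (subInterval N 0 1 (k + 1) (i * N ^ k + j)) := by
    intro j hj
    have hj := Finset.mem_range.1 hj
    have hsub := subInterval_subset hN hj
    -- The same extremal pair serves all branches, so the linear increments `d i * (s - t)` cancel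
    -- in the sum over `i`.
    obtain ⟨s, hs, t, ht, hosc, -⟩ := exists_osc_eq (isCompact_subInterval N k j)
      ⟨_, left_mem_subInterval N k j⟩ (hf.mono hsub)
    have hst := abs_sub_le_of_mem_subInterval hs ht
    -- The increment is split as `S_i(s) (f s - f t) + (S_i(s) - S_i(t)) f t + d i (s - t)`, where
    -- `S_i(u) = S ((u + i) / N)`. The middle errors add up to `lam * maxAbs f` over `N` branches
    -- and `N^k` cells.
    have hstep : ∀ i ∈ Finset.range N, S ((s + i) / N) * osc f (subInterval N 0 1 k j) -
        lam * maxAbs f * (1 / (N : ℝ) ^ k) / N + d i * (s - t) ≤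
        osc f (subInterval N 0 1 (k + 1) (i * N ^ k + j)) := by
      intro i hi
      have hi := Finset.mem_range.1 hi
      have h1 := abs_sub_le_osc (isCompact_subInterval N (k + 1) (i * N ^ k + j))
        (hf.mono (subInterval_subset hN (child_lt hi hj)))
        ((branch_mem_subInterval hN).2 hs) ((branch_mem_subInterval hN).2 ht)
      rw [haff i hi s (hsub hs), haff i hi t (hsub ht)] at h1
      have h2 : |S ((s + i) / N) - S ((t + i) / N)| ≤ lam * ((1 / (N : ℝ) ^ k) / N) := by
        refine (hSlip _ (branch_mem hi (hsub hs)) _ (branch_mem hi (hsub ht))).trans ?_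
        rw [abs_branch_sub]
        gcongr
      have h3 : |(S ((s + i) / N) - S ((t + i) / N)) * f t| ≤
          lam * ((1 / (N : ℝ) ^ k) / N) * maxAbs f := by
        rw [abs_mul]
        exact mul_le_mul h2 (abs_le_maxAbs hf (hsub ht)) (abs_nonneg _) (by positivity)
      have h4 := neg_abs_le ((S ((s + i) / N) - S ((t + i) / N)) * f t)
      have h5 := (le_abs_self _).trans h1
      rw [hosc]
      have e : lam * maxAbs f * (1 / (N : ℝ) ^ k) / N =
        lam * ((1 / (N : ℝ) ^ k) / N) * maxAbs f := by ring
      rw [e]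
      linarith
    refine le_trans ?_ (Finset.sum_le_sum hstep)
    rw [Finset.sum_add_distrib, Finset.sum_sub_distrib, ← Finset.sum_mul, ← Finset.sum_mul, hd,
      Finset.sum_const, Finset.card_range, nsmul_eq_mul, mul_div_cancel₀ _ hN'.ne', zero_mul,
      add_zero]
    exact sub_le_sub_right (mul_le_mul_of_nonneg_right (gammaMin_le hSpos (hsub hs))
      (osc_nonneg _ _)) _
  refine le_trans ?_ (Finset.sum_le_sum hcell)
  rw [Finset.sum_sub_distrib, ← Finset.mul_sum, Finset.sum_const, Finset.card_range, nsmul_eq_mul]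
  refine sub_le_sub_left (le_of_eq ?_) _
  push_cast
  field_simp

/-- The sum of the oscillations of `f` over the cells of level `k`, weighted by the values of `φ` at
their left end points. -/
noncomputable def weightedOsc (N : ℕ) (f φ : ℝ → ℝ) (k : ℕ) : ℝ :=
  ∑ j ∈ Finset.range (N ^ k), φ ((j : ℝ) / (N : ℝ) ^ k) * osc f (subInterval N 0 1 k j)

/-- The scaling is frozen at the left end point. This costs `lam * maxAbs f / N^k` at each of the
two points of a pair, and the linear part costs `|d i| / N^k`. -/
theorem abs_osc_child_sub_le {N : ℕ} {S f : ℝ → ℝ} {lam : ℝ}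
    (hSlip : ∀ s ∈ Icc (0 : ℝ) 1, ∀ t ∈ Icc (0 : ℝ) 1, |S s - S t| ≤ lam * |s - t|)
    (hSpos : ∀ t ∈ Icc (0 : ℝ) 1, 0 < S t) (hlam : 0 ≤ lam) (hf : ContinuousOn f (Icc 0 1))
    {a d : ℕ → ℝ} (haff : SelfAffine N S f a d) {i j k : ℕ} (hi : i < N) (hj : j < N ^ k) :
    |osc f (subInterval N 0 1 (k + 1) (i * N ^ k + j)) -
      S (((j : ℝ) / (N : ℝ) ^ k + i) / N) * osc f (subInterval N 0 1 k j)| ≤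
      (2 * (lam * maxAbs f) + |d i|) * (1 / (N : ℝ) ^ k) := by
  have hN : 0 < N := by omega
  have hN' : (1 : ℝ) ≤ N := by exact_mod_cast hN
  have hsub := subInterval_subset hN hj
  set x := (j : ℝ) / (N : ℝ) ^ k with hx
  set δ := 1 / (N : ℝ) ^ k with hδ
  have hδ0 : 0 ≤ δ := by positivity
  have hxm : x ∈ subInterval N 0 1 k j := left_mem_subInterval N k j
  have hc := (hSpos _ (branch_mem hi (hsub hxm))).le
  set c := S ((x + i) / N) with hcdef
  have hdiff : ∀ s ∈ subInterval N 0 1 k j, ∀ t ∈ subInterval N 0 1 k j,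
      |(f ((s + i) / N) - f ((t + i) / N)) - c * (f s - f t)| ≤
        (2 * (lam * maxAbs f) + |d i|) * δ := by
    intro s hs t ht
    have hS : ∀ u ∈ subInterval N 0 1 k j,
        |(S ((u + i) / N) - c) * f u| ≤ lam * maxAbs f * δ := by
      intro u hu
      rw [abs_mul]
      have h1 : |S ((u + i) / N) - c| ≤ lam * δ := by
        refine (hSlip _ (branch_mem hi (hsub hu)) _ (branch_mem hi (hsub hxm))).trans ?_
        rw [abs_branch_sub]
        refine mul_le_mul_of_nonneg_left ?_ hlam
        exact (div_le_self (abs_nonneg _) hN').trans (abs_sub_le_of_mem_subInterval hu hxm)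
      calc _ ≤ lam * δ * maxAbs f :=
            mul_le_mul h1 (abs_le_maxAbs hf (hsub hu)) (abs_nonneg _) (by positivity)
        _ = _ := by ring
    have hd : |d i * (s - t)| ≤ |d i| * δ := by
      rw [abs_mul]
      exact mul_le_mul_of_nonneg_left (abs_sub_le_of_mem_subInterval hs ht) (abs_nonneg _)
    rw [haff i hi s (hsub hs), haff i hi t (hsub ht)]
    have h1 := abs_le.1 (hS s hs)
    have h2 := abs_le.1 (hS t ht)
    have h3 := abs_le.1 hd
    rw [abs_le]
    constructor <;> linarith [h1.1, h1.2, h2.1, h2.2, h3.1, h3.2]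
  have hfJ := hf.mono hsub
  have hfJ' := hf.mono (subInterval_subset hN (child_lt hi hj))
  rw [abs_sub_le_iff]
  constructor
  · rw [sub_le_iff_le_add]
    refine osc_le ⟨_, left_mem_subInterval _ _ _⟩ fun u hu v hv => ?_
    obtain ⟨s, hs, rfl⟩ := exists_branch_eq hN hu
    obtain ⟨t, ht, rfl⟩ := exists_branch_eq hN hv
    have h1 := hdiff s hs t ht
    have h2 := abs_sub_abs_le_abs_sub (f ((s + i) / N) - f ((t + i) / N)) (c * (f s - f t))
    have h3 : |c * (f s - f t)| ≤ c * osc f (subInterval N 0 1 k j) := by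
      rw [abs_mul, abs_of_nonneg hc]
      exact mul_le_mul_of_nonneg_left (abs_sub_le_osc (isCompact_subInterval N k j) hfJ hs ht) hc
    linarith
  · obtain ⟨s, hs, t, ht, hosc, -⟩ := exists_osc_eq (isCompact_subInterval N k j)
      ⟨_, left_mem_subInterval N k j⟩ hfJ
    have h1 := abs_le.1 (hdiff s hs t ht)
    have h2 := (le_abs_self _).trans (abs_sub_le_osc (isCompact_subInterval N (k + 1)
      (i * N ^ k + j)) hfJ' ((branch_mem_subInterval hN).2 hs) ((branch_mem_subInterval hN).2 ht))
    rw [hosc]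
    linarith [h1.1, h1.2]

/-- Grouping by branches produces the transfer operator. The errors are `O(1 / N^k)` for each of `N
* N^k` terms, with bounded weights, so their total is bounded uniformly in `k`. -/
theorem abs_weightedOsc_succ_sub_le {N : ℕ} (hN : 0 < N) {S f φ : ℝ → ℝ} {lam K : ℝ} (hK : 0 ≤ K)
    (hSlip : ∀ s ∈ Icc (0 : ℝ) 1, ∀ t ∈ Icc (0 : ℝ) 1, |S s - S t| ≤ lam * |s - t|)
    (hSpos : ∀ t ∈ Icc (0 : ℝ) 1, 0 < S t) (hlam : 0 ≤ lam) (hf : ContinuousOn f (Icc 0 1))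
    {a d : ℕ → ℝ} (haff : SelfAffine N S f a d) (hφ : LogLip K φ) :
    ∃ C, 0 ≤ C ∧ ∀ k,
      |weightedOsc N f φ (k + 1) - weightedOsc N f (transfer N S φ) k| ≤ C := by
  have hN' : (0 : ℝ) < N := by exact_mod_cast hN
  have h0 : (0 : ℝ) ∈ Icc (0 : ℝ) 1 := ⟨le_rfl, zero_le_one⟩
  have hM : 0 ≤ maxAbs f := (abs_nonneg _).trans (abs_le_maxAbs hf h0)
  set Φ := Real.exp (K * 1) * φ 0 with hΦ
  have hφ0 := (hφ 0 h0).1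
  have hΦle : ∀ t ∈ Icc (0 : ℝ) 1, φ t ≤ Φ := fun t ht =>
    hφ.le_mul hK ht h0 (by rw [sub_zero, abs_of_nonneg ht.1]; exact ht.2)
  refine ⟨∑ i ∈ Finset.range N, Φ * (2 * (lam * maxAbs f) + |d i|),
    Finset.sum_nonneg fun i _ => by positivity, fun k => ?_⟩
  have e1 : weightedOsc N f φ (k + 1) = ∑ i ∈ Finset.range N, ∑ j ∈ Finset.range (N ^ k),
      φ (((j : ℝ) / (N : ℝ) ^ k + i) / N) *
        osc f (subInterval N 0 1 (k + 1) (i * N ^ k + j)) := by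
    rw [weightedOsc]
    have : N ^ (k + 1) = N * N ^ k := pow_succ' _ _
    rw [this, sum_range_mul_eq]
    refine Finset.sum_congr rfl fun i _ => Finset.sum_congr rfl fun j _ => ?_
    congr 2
    push_cast
    field_simp
    ring
  have e2 : weightedOsc N f (transfer N S φ) k = ∑ i ∈ Finset.range N,
      ∑ j ∈ Finset.range (N ^ k), φ (((j : ℝ) / (N : ℝ) ^ k + i) / N) *
        (S (((j : ℝ) / (N : ℝ) ^ k + i) / N) * osc f (subInterval N 0 1 k j)) := by
    simp only [weightedOsc, transfer, Finset.sum_mul]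
    rw [Finset.sum_comm]
    exact Finset.sum_congr rfl fun _ _ => Finset.sum_congr rfl fun _ _ => by ring
  rw [e1, e2, ← Finset.sum_sub_distrib]
  refine (Finset.abs_sum_le_sum_abs _ _).trans (Finset.sum_le_sum fun i hi => ?_)
  have hi := Finset.mem_range.1 hi
  rw [← Finset.sum_sub_distrib]
  refine (Finset.abs_sum_le_sum_abs _ _).trans ?_
  have hterm : ∀ j ∈ Finset.range (N ^ k), |φ (((j : ℝ) / (N : ℝ) ^ k + i) / N) *
        osc f (subInterval N 0 1 (k + 1) (i * N ^ k + j)) -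
        φ (((j : ℝ) / (N : ℝ) ^ k + i) / N) *
        (S (((j : ℝ) / (N : ℝ) ^ k + i) / N) * osc f (subInterval N 0 1 k j))| ≤
      Φ * ((2 * (lam * maxAbs f) + |d i|) * (1 / (N : ℝ) ^ k)) := by
    intro j hj
    have hj := Finset.mem_range.1 hj
    have hp := branch_mem hi (node_mem hN hj)
    rw [← mul_sub, abs_mul, abs_of_pos (hφ _ hp).1]
    exact mul_le_mul (hΦle _ hp) (abs_osc_child_sub_le hSlip hSpos hlam hf haff hi hj)
      (abs_nonneg _) (by positivity)
  refine (Finset.sum_le_sum hterm).trans (le_of_eq ?_)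
  rw [Finset.sum_const, Finset.card_range, nsmul_eq_mul]
  push_cast
  field_simp

/-! ### Growth of the oscillation sums -/

/-- `C / (r - 1)` is the fixed point of `x ↦ r x - C`; the excess of `b` over it is multiplied by at
least `r` at each step. -/
theorem exists_pow_le_of_recurrence {b : ℕ → ℝ} {r C : ℝ} (hr : 1 < r) (hC : 0 ≤ C)
    (hb : ∀ k, r * b k - C ≤ b (k + 1)) {m : ℕ} (hm : C / (r - 1) < b m) :
    ∃ c, 0 < c ∧ ∀ᶠ k in atTop, c * r ^ k ≤ b k := by
  have hr0 : 0 < r := by linarith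
  have hr1 : 0 < r - 1 := by linarith
  have he0 : 0 ≤ C / (r - 1) := div_nonneg hC hr1.le
  set e := C / (r - 1) with he
  have heC : e * (r - 1) = C := div_mul_cancel₀ _ hr1.ne'
  refine ⟨(b m - e) / r ^ m, div_pos (by linarith) (by positivity), ?_⟩
  filter_upwards [eventually_ge_atTop m] with k hk
  have : (b m - e) / r ^ m * r ^ k ≤ b k - e := by
    induction k, hk using Nat.le_induction with
    | base => rw [div_mul_cancel₀ _ (by positivity)]
    | succ k _ ih =>
      have h1 := mul_le_mul_of_nonneg_left ih hr0.le
      have h2 := hb k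
      rw [pow_succ]
      linarith
  linarith

/-- Likewise `b + C / (r - 1)` grows by at most the factor `r`. -/
theorem exists_le_pow_of_recurrence {b : ℕ → ℝ} {r C : ℝ} (hr : 1 < r) (hC : 0 ≤ C)
    (hb : ∀ k, b (k + 1) ≤ r * b k + C) :
    ∃ c, 0 < c ∧ ∀ k, b k ≤ c * r ^ k := by
  have hr0 : 0 < r := by linarith
  have hr1 : 0 < r - 1 := by linarith
  have he0 : 0 ≤ C / (r - 1) := div_nonneg hC hr1.le
  set e := C / (r - 1) with he
  have heC : e * (r - 1) = C := div_mul_cancel₀ _ hr1.ne'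
  refine ⟨|b 0| + e + 1, by positivity, fun k => ?_⟩
  have : b k + e ≤ (|b 0| + e + 1) * r ^ k := by
    induction k with
    | zero => rw [pow_zero]; linarith [le_abs_self (b 0)]
    | succ k ih =>
      have h1 := mul_le_mul_of_nonneg_left ih hr0.le
      have h2 := hb k
      rw [pow_succ]
      linarith
  linarith

theorem weightedOsc_mono {N : ℕ} (hN : 0 < N) {f φ ψ : ℝ → ℝ}
    (h : ∀ t ∈ Icc (0 : ℝ) 1, φ t ≤ ψ t) (k : ℕ) : weightedOsc N f φ k ≤ weightedOsc N f ψ k :=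
  Finset.sum_le_sum fun _ hj => mul_le_mul_of_nonneg_right
    (h _ (node_mem hN (Finset.mem_range.1 hj))) (osc_nonneg _ _)

theorem weightedOsc_const_mul (N : ℕ) (f φ : ℝ → ℝ) (c : ℝ) (k : ℕ) :
    weightedOsc N f (fun t => c * φ t) k = c * weightedOsc N f φ k := by
  simp only [weightedOsc, Finset.mul_sum, mul_assoc]

theorem weightedOsc_one (N : ℕ) (f : ℝ → ℝ) (k : ℕ) :
    weightedOsc N f (fun _ => 1) k = oscSum N f 0 1 k := by
  simp only [weightedOsc, oscSum, one_mul]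

/-- Weighted and unweighted oscillation sums are comparable. -/
theorem weightedOsc_comparable {N : ℕ} (hN : 0 < N) {K : ℝ} (hK : 0 ≤ K) {f φ : ℝ → ℝ}
    (hφ : LogLip K φ) : ∃ D, 0 < D ∧ ∀ k, weightedOsc N f φ k ≤ D * oscSum N f 0 1 k ∧
      oscSum N f 0 1 k ≤ D * weightedOsc N f φ k := by
  have h0 : (0 : ℝ) ∈ Icc (0 : ℝ) 1 := ⟨le_rfl, zero_le_one⟩
  have hφ0 := (hφ 0 h0).1
  have hE := Real.exp_pos (K * 1)
  have hup : ∀ t ∈ Icc (0 : ℝ) 1, φ t ≤ Real.exp (K * 1) * φ 0 := fun t ht =>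
    hφ.le_mul hK ht h0 (by rw [sub_zero, abs_of_nonneg ht.1]; exact ht.2)
  have hdn : ∀ t ∈ Icc (0 : ℝ) 1, φ 0 ≤ Real.exp (K * 1) * φ t := fun t ht =>
    hφ.le_mul hK h0 ht (by rw [zero_sub, abs_neg, abs_of_nonneg ht.1]; exact ht.2)
  refine ⟨max (Real.exp (K * 1) * φ 0) (Real.exp (K * 1) / φ 0),
    lt_max_of_lt_left (by positivity), fun k => ⟨?_, ?_⟩⟩
  · rw [← weightedOsc_one, ← weightedOsc_const_mul]
    refine weightedOsc_mono hN (fun t ht => ?_) k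
    rw [mul_one]
    exact (hup t ht).trans (le_max_left _ _)
  · rw [← weightedOsc_one, ← weightedOsc_const_mul]
    refine weightedOsc_mono hN (fun t ht => ?_) k
    calc (1 : ℝ) ≤ Real.exp (K * 1) / φ 0 * φ t := by
          rw [div_mul_eq_mul_div]; exact (one_le_div hφ0).2 (hdn t ht)
      _ ≤ _ := mul_le_mul_of_nonneg_right (le_max_right _ _) (hφ t ht).1.le

theorem tendsto_oscSum_atTop {N : ℕ} (hN : 0 < N) {S f : ℝ → ℝ} {lam : ℝ}
    (hSlip : ∀ s ∈ Icc (0 : ℝ) 1, ∀ t ∈ Icc (0 : ℝ) 1, |S s - S t| ≤ lam * |s - t|)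
    (hSpos : ∀ t ∈ Icc (0 : ℝ) 1, 0 < S t) (hlam : 0 ≤ lam) (hf : ContinuousOn f (Icc 0 1))
    {a d : ℕ → ℝ} (haff : SelfAffine N S f a d) (hd : ∑ i ∈ Finset.range N, d i = 0)
    (hγ : 1 < gammaMin N S) {m : ℕ}
    (hm : lam * maxAbs f / (gammaMin N S - 1) < oscSum N f 0 1 m) :
    Tendsto (oscSum N f 0 1) atTop atTop := by
  have hM : 0 ≤ maxAbs f := (abs_nonneg _).trans (abs_le_maxAbs hf ⟨le_rfl, zero_le_one⟩)
  obtain ⟨c, hc, h⟩ := exists_pow_le_of_recurrence hγ (mul_nonneg hlam hM)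
    (oscSum_succ_ge hN hSlip hSpos hlam hf haff hd) hm
  exact tendsto_atTop_mono' _ h ((tendsto_pow_atTop_atTop_of_one_lt hγ).const_mul_atTop hc)

/-- The oscillation sums grow with the growth rate of the transfer operator. -/
theorem tendsto_log_oscSum_div {N : ℕ} (hN : 0 < N) {S f : ℝ → ℝ} {lam K : ℝ} (hK : 0 ≤ K)
    (hSlip : ∀ s ∈ Icc (0 : ℝ) 1, ∀ t ∈ Icc (0 : ℝ) 1, |S s - S t| ≤ lam * |s - t|)
    (hSpos : ∀ t ∈ Icc (0 : ℝ) 1, 0 < S t) (hlam : 0 ≤ lam) (hf : ContinuousOn f (Icc 0 1))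
    {a d : ℕ → ℝ} (haff : SelfAffine N S f a d)
    (htop : Tendsto (oscSum N f 0 1) atTop atTop) {ρ : ℝ} (hρ : 1 < ρ)
    (hlow : ∀ r, 0 < r → r < ρ →
      ∃ φ, LogLip K φ ∧ ∀ t ∈ Icc (0 : ℝ) 1, r * φ t ≤ transfer N S φ t)
    (hup : ∀ r, ρ < r → ∃ φ, LogLip K φ ∧ ∀ t ∈ Icc (0 : ℝ) 1, transfer N S φ t ≤ r * φ t) :
    Tendsto (fun k : ℕ => Real.log (oscSum N f 0 1 k) / k) atTop (𝓝 (Real.log ρ)) := by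
  have hρ0 : 0 < ρ := by linarith
  have hlim : ∀ c r : ℝ,
      Tendsto (fun k : ℕ => Real.log c / k + Real.log r) atTop (𝓝 (Real.log r)) := fun c r => by
    simpa using (tendsto_const_div_atTop_nhds_zero_nat (Real.log c)).add_const (Real.log r)
  have hlog : ∀ {c r : ℝ} {k : ℕ}, 0 < c → 0 < r → k ≠ 0 →
      Real.log (c * r ^ k) / k = Real.log c / k + Real.log r := fun {c r k} hc hr hk => by
    rw [Real.log_mul hc.ne' (by positivity), Real.log_pow, add_div, mul_div_cancel_left₀]
    exact_mod_cast hk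
  rw [tendsto_order]
  constructor
  · intro b hb
    -- The recurrence needs `r > 1`; there is room because `ρ > 1`.
    have hb' : max (Real.exp b) 1 < ρ :=
      max_lt ((Real.lt_log_iff_exp_lt hρ0).1 hb) hρ
    obtain ⟨r, hr1, hr2⟩ := exists_between hb'
    have hr : 1 < r := (le_max_right _ _).trans_lt hr1
    have hr0 : 0 < r := by linarith
    have hbr : b < Real.log r := (Real.lt_log_iff_exp_lt hr0).2 ((le_max_left _ _).trans_lt hr1)
    obtain ⟨φ, hφ, h⟩ := hlow r hr0 hr2
    obtain ⟨C, hC, hrec⟩ := abs_weightedOsc_succ_sub_le hN hK hSlip hSpos hlam hf haff hφ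
    obtain ⟨D, hD, hcomp⟩ := weightedOsc_comparable (f := f) hN hK hφ
    -- `C` depends on `φ`, so the assumed threshold does not suffice here; unboundedness passes any
    -- threshold.
    obtain ⟨m, hm⟩ := (htop.eventually_gt_atTop (D * (C / (r - 1)))).exists
    have hm' : C / (r - 1) < weightedOsc N f φ m :=
      lt_of_mul_lt_mul_left (hm.trans_le (hcomp m).2) hD.le
    obtain ⟨c, hc, hgrow⟩ := exists_pow_le_of_recurrence hr hC (fun k => by
      have h1 := (abs_le.1 (hrec k)).1
      have h2 := weightedOsc_mono (f := f) hN h k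
      rw [weightedOsc_const_mul] at h2
      linarith) hm'
    filter_upwards [hgrow, (hlim (c / D) r).eventually_const_lt hbr, eventually_ne_atTop 0]
      with k hk1 hk2 hk0
    refine hk2.trans_le ?_
    rw [← hlog (div_pos hc hD) hr0 hk0]
    gcongr
    rw [div_mul_eq_mul_div, div_le_iff₀' hD]
    exact hk1.trans (hcomp k).1
  · intro b hb
    obtain ⟨r, hr1, hr2⟩ := exists_between ((Real.log_lt_iff_lt_exp hρ0).1 hb)
    have hr : 1 < r := hρ.trans hr1
    have hr0 : 0 < r := by linarith
    have hbr : Real.log r < b := (Real.log_lt_iff_lt_exp hr0).2 hr2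
    obtain ⟨φ, hφ, h⟩ := hup r hr1
    obtain ⟨C, hC, hrec⟩ := abs_weightedOsc_succ_sub_le hN hK hSlip hSpos hlam hf haff hφ
    obtain ⟨D, hD, hcomp⟩ := weightedOsc_comparable (f := f) hN hK hφ
    obtain ⟨c, hc, hgrow⟩ := exists_le_pow_of_recurrence (b := weightedOsc N f φ) hr hC
      (fun k => by
        have h1 := (abs_le.1 (hrec k)).2
        have h2 := weightedOsc_mono (f := f) hN h k
        rw [weightedOsc_const_mul] at h2
        linarith)
    filter_upwards [htop.eventually_gt_atTop 0, (hlim (D * c) r).eventually_lt_const hbr,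
      eventually_ne_atTop 0] with k hk1 hk2 hk0
    refine lt_of_le_of_lt ?_ hk2
    rw [← hlog (mul_pos hD hc) hr0 hk0]
    gcongr
    rw [mul_assoc]
    exact (hcomp k).2.trans (mul_le_mul_of_nonneg_left (hgrow k) hD.le)

/-! ### Counting squares -/

/-- The indices `m` for which `[m ε, (m + 1) ε]` meets `[a, b]`. -/
noncomputable def gridIndices (ε a b : ℝ) : Finset ℤ := Finset.Icc (⌈a / ε⌉ - 1) ⌊b / ε⌋

theorem mem_gridIndices {ε a b x : ℝ} (hε : 0 < ε) (hx : x ∈ Icc a b) {m : ℤ}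
    (hm : x ∈ Icc ((m : ℝ) * ε) ((m + 1) * ε)) : m ∈ gridIndices ε a b := by
  rw [gridIndices, Finset.mem_Icc, sub_le_iff_le_add, Int.ceil_le, Int.le_floor]
  push_cast
  exact ⟨(div_le_iff₀ hε).2 (hx.1.trans hm.2), (le_div_iff₀ hε).2 (hm.1.trans hx.2)⟩

theorem card_gridIndices_le {ε a b : ℝ} (hε : 0 < ε) (hab : a ≤ b) :
    ((gridIndices ε a b).card : ℝ) ≤ (b - a) / ε + 2 := by
  rw [gridIndices, Int.card_Icc]
  have h1 := Int.floor_le (b / ε)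
  have h2 := Int.le_ceil (a / ε)
  have h3 : 0 ≤ (b - a) / ε := div_nonneg (sub_nonneg.2 hab) hε.le
  have h4 : (((⌊b / ε⌋ + 1 - (⌈a / ε⌉ - 1)).toNat : ℤ) : ℝ) ≤ (b - a) / ε + 2 := by
    rw [Int.toNat_eq_max]
    push_cast
    refine max_le ?_ (by linarith)
    rw [sub_div]
    linarith
  exact_mod_cast h4

theorem exists_mem_subInterval {N : ℕ} (hN : 0 < N) (k : ℕ) {t : ℝ} (ht : t ∈ Icc (0 : ℝ) 1) :
    ∃ j < N ^ k, t ∈ subInterval N 0 1 k j := by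
  have hN' : (0 : ℝ) < (N : ℝ) ^ k := pow_pos (by exact_mod_cast hN) k
  simp only [subInterval_unit]
  rcases ht.2.lt_or_eq with h | rfl
  · refine ⟨⌊t * (N : ℝ) ^ k⌋₊, ?_, ?_, ?_⟩
    · rw [Nat.floor_lt (mul_nonneg ht.1 hN'.le)]
      push_cast
      nlinarith
    · rw [div_le_iff₀ hN']
      exact Nat.floor_le (mul_nonneg ht.1 hN'.le)
    · rw [le_div_iff₀ hN']
      exact (Nat.lt_floor_add_one _).le
  -- At `t = 1` the floor would give the index `N^k`, which is out of range; the last cell is used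
  -- instead.
  · have hpos : 0 < N ^ k := by positivity
    have hcast : ((N ^ k - 1 : ℕ) : ℝ) = (N : ℝ) ^ k - 1 := by
      rw [Nat.cast_sub hpos]; push_cast; rfl
    refine ⟨N ^ k - 1, by omega, ?_, ?_⟩
    · rw [hcast, div_le_one hN']; linarith
    · rw [hcast, le_div_iff₀ hN']; linarith

/-- A finite set containing all squares that meet the graph of `f` over the `j`-th cell of level
`k`. -/
theorem exists_finset_cover {N : ℕ} (hN : 0 < N) {f : ℝ → ℝ} (hf : ContinuousOn f (Icc 0 1)) {k : ℕ}
    {ε : ℝ} (hε : 0 < ε) (hk : 1 ≤ ε * (N : ℝ) ^ k) {j : ℕ} (hj : j < N ^ k) :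
    ∃ G : Finset (ℤ × ℤ), (∀ p : ℤ × ℤ, ∀ t ∈ subInterval N 0 1 k j,
      (t, f t) ∈ coordSquare ε p → p ∈ G) ∧
      (G.card : ℝ) ≤ 3 * (osc f (subInterval N 0 1 k j) / ε + 2) := by
  have hN' : (0 : ℝ) < (N : ℝ) ^ k := pow_pos (by exact_mod_cast hN) k
  obtain ⟨s, hs, t, ht, hosc, hrange⟩ := exists_osc_eq (isCompact_subInterval N k j)
    ⟨_, left_mem_subInterval N k j⟩ (hf.mono (subInterval_subset hN hj))
  refine ⟨gridIndices ε ((j : ℝ) / (N : ℝ) ^ k) (((j : ℝ) + 1) / (N : ℝ) ^ k) ×ˢ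
    gridIndices ε (f t) (f s), fun p u hu hp => ?_, ?_⟩
  · rw [Finset.mem_product]
    exact ⟨mem_gridIndices hε (by rwa [subInterval_unit] at hu) hp.1,
      mem_gridIndices hε (hrange u hu) hp.2⟩
  · rw [Finset.card_product, Nat.cast_mul, hosc]
    have h1 := card_gridIndices_le hε (a := (j : ℝ) / (N : ℝ) ^ k)
      (b := ((j : ℝ) + 1) / (N : ℝ) ^ k) (by gcongr; linarith)
    have h2 := card_gridIndices_le hε (hrange s hs).1
    -- The cell is no wider than `ε`, so it touches at most three columns of closed squares.
    have h3 : (((j : ℝ) + 1) / (N : ℝ) ^ k - (j : ℝ) / (N : ℝ) ^ k) / ε ≤ 1 := by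
      rw [← sub_div, add_sub_cancel_left, div_div, div_le_one (by positivity)]
      linarith
    exact mul_le_mul (by linarith) h2 (Nat.cast_nonneg _) (by norm_num)

theorem boxCount_le {N : ℕ} (hN : 0 < N) {f : ℝ → ℝ} (hf : ContinuousOn f (Icc 0 1)) {k : ℕ}
    {ε : ℝ} (hε : 0 < ε) (hk : 1 ≤ ε * (N : ℝ) ^ k) :
    {p : ℤ × ℤ | (coordSquare ε p ∩ graphOver f 0 1).Nonempty}.Finite ∧
    (boxCount (graphOver f 0 1) ε : ℝ) ≤ 3 * (N : ℝ) ^ k * (oscSum N f 0 1 k + 2) := by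
  have hex := fun j : ℕ => fun hj : j < N ^ k => exists_finset_cover hN hf hε hk hj
  choose! G hG hcard using hex
  have hsub : {p : ℤ × ℤ | (coordSquare ε p ∩ graphOver f 0 1).Nonempty} ⊆
      ↑((Finset.range (N ^ k)).biUnion G) := by
    rintro p ⟨_, hp, t, ht, rfl⟩
    obtain ⟨j, hj, htj⟩ := exists_mem_subInterval hN k ht
    exact Finset.mem_coe.2 (Finset.mem_biUnion.2 ⟨j, Finset.mem_range.2 hj, hG j hj p t htj hp⟩)
  refine ⟨(Finset.finite_toSet _).subset hsub, ?_⟩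
  have h1 : boxCount (graphOver f 0 1) ε ≤ ∑ j ∈ Finset.range (N ^ k), (G j).card := by
    refine (ncard_le_ncard hsub (Finset.finite_toSet _)).trans ?_
    rw [ncard_coe_finset]
    exact Finset.card_biUnion_le
  have hO : 0 ≤ oscSum N f 0 1 k := Finset.sum_nonneg fun _ _ => osc_nonneg _ _
  have hinv : 1 / ε ≤ (N : ℝ) ^ k := by rw [div_le_iff₀ hε]; linarith
  calc (boxCount (graphOver f 0 1) ε : ℝ) ≤ ∑ j ∈ Finset.range (N ^ k), ((G j).card : ℝ) := by
        exact_mod_cast h1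
    _ ≤ ∑ j ∈ Finset.range (N ^ k), 3 * (osc f (subInterval N 0 1 k j) / ε + 2) :=
        Finset.sum_le_sum fun j hj => hcard j (Finset.mem_range.1 hj)
    _ = 3 * (oscSum N f 0 1 k * (1 / ε) + (N : ℝ) ^ k * 2) := by
        rw [← Finset.mul_sum, Finset.sum_add_distrib, ← Finset.sum_div, Finset.sum_const,
          Finset.card_range, nsmul_eq_mul, ← oscSum]
        push_cast
        ring
    _ ≤ 3 * (oscSum N f 0 1 k * (N : ℝ) ^ k + (N : ℝ) ^ k * 2) := by gcongr
    _ = _ := by ring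

/-- By the intermediate value theorem `f` takes on `U` all values between its extremes, so every
horizontal strip of height `ε` between them contributes a square. -/
theorem osc_div_le_card {U : Set ℝ} (hU : IsCompact U) (hconn : IsPreconnected U)
    (hne : U.Nonempty) {f : ℝ → ℝ} (hf : ContinuousOn f U) {ε : ℝ} (hε : 0 < ε)
    {G : Finset (ℤ × ℤ)} (hG : ∀ p : ℤ × ℤ, ∀ t ∈ U, (t, f t) ∈ coordSquare ε p → p ∈ G) :
    osc f U / ε ≤ G.card := by
  obtain ⟨s, hs, t, ht, hosc, hrange⟩ := exists_osc_eq hU hne hf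
  have hsub : Finset.Icc ⌊f t / ε⌋ ⌊f s / ε⌋ ⊆ G.image Prod.snd := by
    intro a ha
    obtain ⟨ha1, ha2⟩ := Finset.mem_Icc.1 ha
    have h1 : f t ≤ ((a : ℝ) + 1) * ε := by
      rw [← div_le_iff₀ hε]
      refine (Int.lt_floor_add_one _).le.trans ?_
      exact_mod_cast add_le_add_left ha1 1
    have h2 : (a : ℝ) * ε ≤ f s := by
      rw [← le_div_iff₀ hε]
      exact Int.le_floor.1 ha2
    -- This is a value of `f` that lies in the strip of index `a`.
    have hv : max (f t) (a * ε) ∈ Icc (f t) (f s) :=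
      ⟨le_max_left _ _, max_le (hrange s hs).1 h2⟩
    obtain ⟨x, hx, hfx⟩ := hconn.intermediate_value ht hs hf hv
    refine Finset.mem_image.2 ⟨(⌊x / ε⌋, a), hG _ x hx ⟨⟨?_, ?_⟩, ?_, ?_⟩, rfl⟩
    · exact (le_div_iff₀ hε).1 (Int.floor_le _)
    · exact (div_le_iff₀ hε).1 (Int.lt_floor_add_one _).le
    · exact (le_max_right _ _).trans_eq hfx.symm
    · refine hfx.trans_le (max_le h1 ?_)
      exact mul_le_mul_of_nonneg_right (by linarith) hε.le
  have hcard := (Finset.card_le_card hsub).trans Finset.card_image_le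
  rw [Int.card_Icc] at hcard
  have h1 : ⌊f s / ε⌋ + 1 - ⌊f t / ε⌋ ≤ (G.card : ℤ) :=
    (Int.self_le_toNat _).trans (by exact_mod_cast hcard)
  have h2 : ((⌊f s / ε⌋ : ℝ) + 1 - ⌊f t / ε⌋) ≤ G.card := by exact_mod_cast h1
  have h3 := Int.lt_floor_add_one (f s / ε)
  have h4 := Int.floor_le (f t / ε)
  rw [hosc, sub_div]
  linarith

/-- Double counting of incident pairs of cells and squares: a cell meets at least `osc / ε` squares,
while a square, of width at most `N` cell widths, meets at most `N + 2` cells. -/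
theorem le_boxCount {N : ℕ} (hN : 0 < N) {f : ℝ → ℝ} (hf : ContinuousOn f (Icc 0 1)) {k : ℕ}
    {ε : ℝ} (hε : 0 < ε) (hk : 1 ≤ ε * (N : ℝ) ^ k) (hk' : ε * (N : ℝ) ^ k ≤ N) :
    (N : ℝ) ^ k * oscSum N f 0 1 k / (N * (N + 2)) ≤ boxCount (graphOver f 0 1) ε := by
  classical
  have hN0 : (0 : ℝ) < N := by exact_mod_cast hN
  have hNk : (0 : ℝ) < (N : ℝ) ^ k := by positivity
  have hfin := (boxCount_le hN hf hε hk).1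
  set F := hfin.toFinset with hF
  have hcount : boxCount (graphOver f 0 1) ε = F.card := by
    rw [boxCount, hF, ncard_eq_toFinset_card _ hfin]
  let R : ℕ → ℤ × ℤ → Prop := fun j p => ∃ t ∈ subInterval N 0 1 k j, (t, f t) ∈ coordSquare ε p
  have hrow : ∀ j ∈ Finset.range (N ^ k), osc f (subInterval N 0 1 k j) / ε ≤
      ((F.bipartiteAbove R j).card : ℝ) := by
    intro j hj
    have hsub := subInterval_subset hN (Finset.mem_range.1 hj)
    refine osc_div_le_card (isCompact_subInterval N k j) isPreconnected_Icc
      ⟨_, left_mem_subInterval N k j⟩ (hf.mono hsub) hε fun p t ht hp => ?_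
    rw [Finset.mem_bipartiteAbove]
    exact ⟨hfin.mem_toFinset.2 ⟨_, hp, t, hsub ht, rfl⟩, t, ht, hp⟩
  have hcol : ∀ p ∈ F, (((Finset.range (N ^ k)).bipartiteBelow R p).card : ℝ) ≤ N + 2 := by
    intro p _
    -- The cells are themselves grid intervals of mesh `1 / N^k`, so `gridIndices` counts them too.
    have hmaps : ((Finset.range (N ^ k)).bipartiteBelow R p).card ≤
        (gridIndices (1 / (N : ℝ) ^ k) (p.1 * ε) ((p.1 + 1) * ε)).card := by
      refine Finset.card_le_card_of_injOn (fun j : ℕ => (j : ℤ)) (fun j hj => ?_)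
        (fun a _ b _ h => Int.ofNat_inj.1 h)
      obtain ⟨-, t, ht, hp⟩ := (Finset.mem_bipartiteBelow R).1 hj
      refine mem_gridIndices (by positivity) hp.1 ?_
      rw [subInterval_unit] at ht
      rw [mul_one_div, mul_one_div]
      simpa only [Int.cast_natCast] using ht
    have h1 : (((Finset.range (N ^ k)).bipartiteBelow R p).card : ℝ) ≤
        (gridIndices (1 / (N : ℝ) ^ k) (p.1 * ε) ((p.1 + 1) * ε)).card := by exact_mod_cast hmaps
    refine h1.trans ((card_gridIndices_le (by positivity) (by nlinarith)).trans ?_)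
    have : (((p.1 : ℝ) + 1) * ε - p.1 * ε) / (1 / (N : ℝ) ^ k) = ε * (N : ℝ) ^ k := by
      field_simp; ring
    rw [this]
    linarith
  have hdouble : ∑ j ∈ Finset.range (N ^ k), ((F.bipartiteAbove R j).card : ℝ) =
      ∑ p ∈ F, (((Finset.range (N ^ k)).bipartiteBelow R p).card : ℝ) := by
    exact_mod_cast Finset.sum_card_bipartiteAbove_eq_sum_card_bipartiteBelow R
  have hmain : oscSum N f 0 1 k / ε ≤ (N + 2) * F.card := by
    calc oscSum N f 0 1 k / ε = ∑ j ∈ Finset.range (N ^ k), osc f (subInterval N 0 1 k j) / ε := by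
          rw [oscSum, Finset.sum_div]
      _ ≤ _ := Finset.sum_le_sum hrow
      _ = _ := hdouble
      _ ≤ ∑ p ∈ F, ((N : ℝ) + 2) := Finset.sum_le_sum hcol
      _ = (N + 2) * F.card := by rw [Finset.sum_const, nsmul_eq_mul, mul_comm]
  rw [hcount, div_le_iff₀ (by positivity)]
  have hO : 0 ≤ oscSum N f 0 1 k := Finset.sum_nonneg fun _ _ => osc_nonneg _ _
  have h1 : (N : ℝ) ^ k ≤ N / ε := by rw [le_div_iff₀ hε]; linarith
  calc (N : ℝ) ^ k * oscSum N f 0 1 k ≤ N / ε * oscSum N f 0 1 k := by gcongr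
    _ = N * (oscSum N f 0 1 k / ε) := by ring
    _ ≤ N * ((N + 2) * F.card) := by gcongr
    _ = _ := by ring

/-! ### Box dimension of the graph -/

theorem hasBoxDim_of_tendsto {E : Set (ℝ × ℝ)} {d : ℝ}
    (h : Tendsto (fun ε : ℝ => Real.log (boxCount E ε) / Real.log (1 / ε)) (𝓝[>] 0) (𝓝 d)) :
    HasBoxDim E d := by
  have h' := (continuous_coe_real_ereal.tendsto d).comp h
  exact ⟨h'.limsup_eq, h'.liminf_eq⟩

/-- If the oscillation sums of level `k` grow like `ρ ^ k`, then the graph has box dimension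
`1 + log ρ / log N`. -/
theorem hasBoxDim_graphOver {N : ℕ} (hN : 2 ≤ N) {f : ℝ → ℝ} (hf : ContinuousOn f (Icc 0 1))
    (htop : Tendsto (oscSum N f 0 1) atTop atTop) {l : ℝ}
    (hl : Tendsto (fun k : ℕ => Real.log (oscSum N f 0 1 k) / k) atTop (𝓝 l)) :
    HasBoxDim (graphOver f 0 1) (1 + l / Real.log N) := by
  have hN0 : 0 < N := by omega
  have hN' : (1 : ℝ) < N := by exact_mod_cast (by omega : 1 < N)
  have hNpos : (0 : ℝ) < N := by linarith
  have hL : 0 < Real.log N := Real.log_pos hN'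
  set L := Real.log N with hLdef
  set X : ℝ → ℝ := fun ε => Real.log (1 / ε) with hXdef
  have hX : Tendsto X (𝓝[>] 0) atTop := by
    have : Tendsto (fun ε : ℝ => 1 / ε) (𝓝[>] 0) atTop := by
      simpa using tendsto_inv_nhdsGT_zero (𝕜 := ℝ)
    exact Real.tendsto_log_atTop.comp this
  -- The least level whose cells are no wider than `ε`; hence `1 ≤ ε N^κ ≤ N`.
  set κ : ℝ → ℕ := fun ε => ⌈L⁻¹ * X ε⌉₊ with hκdef
  have hκ : Tendsto κ (𝓝[>] 0) atTop :=
    tendsto_nat_ceil_atTop.comp (hX.const_mul_atTop (inv_pos.2 hL))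
  have hκX : Tendsto (fun ε => (κ ε : ℝ) / X ε) (𝓝[>] 0) (𝓝 L⁻¹) :=
    (tendsto_nat_ceil_mul_div_atTop (inv_pos.2 hL).le).comp hX
  set O := oscSum N f 0 1 with hOdef
  have hlim : ∀ c : ℝ, 0 < c → Tendsto (fun ε => Real.log (c * ((N : ℝ) ^ κ ε * O (κ ε))) / X ε)
      (𝓝[>] 0) (𝓝 (1 + l / L)) := by
    intro c hc
    have h1 : Tendsto (fun ε => Real.log c / X ε + (κ ε : ℝ) / X ε *
        (L + Real.log (O (κ ε)) / (κ ε : ℕ))) (𝓝[>] 0) (𝓝 (0 + L⁻¹ * (L + l))) :=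
      (tendsto_const_nhds.div_atTop hX).add (hκX.mul (tendsto_const_nhds.add (hl.comp hκ)))
    have e : 0 + L⁻¹ * (L + l) = 1 + l / L := by field_simp; ring
    rw [e] at h1
    refine h1.congr' ?_
    filter_upwards [hκ.eventually (htop.eventually_gt_atTop 0), hκ.eventually_ne_atTop 0]
      with ε hO hk0
    have hk0' : ((κ ε : ℕ) : ℝ) ≠ 0 := by exact_mod_cast hk0
    rw [Real.log_mul hc.ne' (by positivity), Real.log_mul (by positivity) hO.ne', Real.log_pow,
      ← hLdef]
    field_simp
  have hbounds : ∀ᶠ ε in 𝓝[>] (0 : ℝ), 0 < ε ∧ 1 ≤ ε * (N : ℝ) ^ κ ε ∧ ε * (N : ℝ) ^ κ ε ≤ N := by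
    filter_upwards [self_mem_nhdsWithin, hX.eventually_gt_atTop 0] with ε hε hXε
    have hε : 0 < ε := hε
    have hpow : 0 < (N : ℝ) ^ κ ε := by positivity
    have hXe : X ε = -Real.log ε := by simp [hXdef]
    have h1 : L⁻¹ * X ε ≤ κ ε := Nat.le_ceil _
    have h2 : (κ ε : ℝ) < L⁻¹ * X ε + 1 :=
      Nat.ceil_lt_add_one (mul_nonneg (inv_pos.2 hL).le hXε.le)
    have hlogeq : Real.log (ε * (N : ℝ) ^ κ ε) = Real.log ε + κ ε * L := by
      rw [Real.log_mul hε.ne' hpow.ne', Real.log_pow]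
    have h3 : X ε ≤ κ ε * L := by
      rw [inv_mul_eq_div] at h1; exact (div_le_iff₀ hL).1 h1
    have h4 : κ ε * L < X ε + L := by
      have := mul_lt_mul_of_pos_right h2 hL
      rwa [add_mul, one_mul, mul_comm L⁻¹, mul_assoc, inv_mul_cancel₀ hL.ne', mul_one] at this
    refine ⟨hε, ?_, ?_⟩
    · rw [← Real.log_nonneg_iff (by positivity), hlogeq]; linarith
    · rw [← Real.log_le_log_iff (by positivity) hNpos, hlogeq]; linarith
  -- Constant factors do not affect the limit. The lower one is that of `le_boxCount`; the upper one
  -- is `9` because `3 (O + 2) ≤ 9 O` once `O ≥ 1`.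
  refine hasBoxDim_of_tendsto (tendsto_of_tendsto_of_tendsto_of_le_of_le'
    (hlim (1 / (N * (N + 2))) (by positivity)) (hlim 9 (by norm_num)) ?_ ?_)
  · filter_upwards [hbounds, hκ.eventually (htop.eventually_gt_atTop 0), hX.eventually_gt_atTop 0]
      with ε ⟨hε, hk1, hk2⟩ hO hXε
    have h := le_boxCount hN0 hf hε hk1 hk2
    refine div_le_div_of_nonneg_right (Real.log_le_log (by positivity) ?_) hXε.le
    rwa [one_div_mul_eq_div]
  · filter_upwards [hbounds, hκ.eventually (htop.eventually_ge_atTop 1), hX.eventually_gt_atTop 0]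
      with ε ⟨hε, hk1, hk2⟩ hO hXε
    have h := (boxCount_le hN0 hf hε hk1).2
    have hpos : 0 < (boxCount (graphOver f 0 1) ε : ℝ) := by
      have hO0 : 0 < oscSum N f 0 1 (κ ε) := by linarith
      exact lt_of_lt_of_le (by positivity) (le_boxCount hN0 hf hε hk1 hk2)
    refine div_le_div_of_nonneg_right (Real.log_le_log hpos (h.trans ?_)) hXε.le
    have hpow : 0 < (N : ℝ) ^ κ ε := by positivity
    nlinarith

end GenAffineFIF

theorem theorem4p11 (N : ℕ) (hN : 2 ≤ N)
    (y : Fin (N + 1) → ℝ) (hy0 : y 0 = 0) (hyN : y (Fin.last N) = 0)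
    (S f : ℝ → ℝ) (lamS : ℝ) (hlam : 0 < lamS)
    (hSlip : ∀ s ∈ Set.Icc (0 : ℝ) 1, ∀ t ∈ Set.Icc (0 : ℝ) 1, |S s - S t| ≤ lamS * |s - t|)
    (hSlt : ∀ t ∈ Set.Icc (0 : ℝ) 1, |S t| < 1)
    (hSpos : ∀ t ∈ Set.Icc (0 : ℝ) 1, 0 < S t)
    (hf : GenAffineFIF.IsGenAffineFIF (GenAffineFIF.unifNodes N) y S f)
    (hγ : 1 < GenAffineFIF.gammaMin N S)
    (hosc : ∃ k₀ : ℕ, 1 ≤ k₀ ∧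
      lamS * GenAffineFIF.maxAbs f / (GenAffineFIF.gammaMin N S - 1) <
        GenAffineFIF.oscSum N f 0 1 k₀) :
    ∃ ρS : ℝ, GenAffineFIF.IsRhoS N S ρS ∧ 0 < ρS ∧
      GenAffineFIF.HasBoxDim (GenAffineFIF.graphOver f 0 1)
        (1 + Real.log ρS / Real.log N) := by
  have hN0 : 0 < N := by omega
  have hcont : ContinuousOn f (Set.Icc 0 1) := by
    have h := hf.continuousOn
    rwa [GenAffineFIF.unifNodes_zero, GenAffineFIF.unifNodes_last hN0] at h
  obtain ⟨a, d, haff, hd⟩ := hf.selfAffine hN0 hy0 hyN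
  obtain ⟨K, hK, hS⟩ := GenAffineFIF.LogLip.of_lipschitz hlam hSlip hSpos
  -- The first iterate of the function `1` is `γ`, so `γ_*` serves as the lower bound `c`, and `ρ ≥
  -- γ_* > 1`.
  obtain ⟨ρ, hρ, hlow, hup⟩ := GenAffineFIF.exists_growthRate hN hK hS hγ fun t ht => by
    simpa [GenAffineFIF.transferIter, GenAffineFIF.transfer] using
      GenAffineFIF.gammaMin_le hSpos ht
  obtain ⟨k₀, -, hk₀⟩ := hosc
  have hρ1 : 1 < ρ := hγ.trans_le hρ
  have hρ0 : 0 < ρ := by linarith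
  have htop := GenAffineFIF.tendsto_oscSum_atTop hN0 hSlip hSpos hlam.le hcont haff hd hγ hk₀
  exact ⟨ρ, ⟨GenAffineFIF.tendsto_specRadius_scaleMatrix hN hK hS hρ0 hlow hup
      (GenAffineFIF.scaleApprox_upper hK hS),
    GenAffineFIF.tendsto_specRadius_scaleMatrix hN hK hS hρ0 hlow hup
      (GenAffineFIF.scaleApprox_lower hK hS)⟩, hρ0,
    GenAffineFIF.hasBoxDim_graphOver hN hcont htop
      (GenAffineFIF.tendsto_log_oscSum_div hN0 hK hSlip hSpos hlam.le hcont haff htop hρ1 hlow hup)⟩
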